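/- Let $n\ge 1$ and let $X\in\mathbb{R}^{n\times 2}$ be a random matrix with i.i.d. $N(0,1)$ entries and rows $x_1,\dots,x_n$. For $D\in\{0,1\}^n$ put $p(D)=\mathbb{P}_{u\sim\mathrm{Unif}(\mathbb{S}^1)}[\,1(Xu\ge 0)=D\,]$ (a random variable depending on $X$), and let $\bar D$ denote the complement of $D$. Call $D$ an activation pattern if $1(Xu\ge0)=D$ for some $u\in\mathbb{S}^1$. Let $E_1,\dots,E_n$ be i.i.d. $\mathrm{Exp}(1)$ random variables. (1) For every $k\in\{1,\dots,n\}$, almost surely there are exactly $2n$ activation patterns, and they can be listed in a unique way as $D_1,\dots,D_n,\bar D_1,\dots,\bar D_n$, where $D_1,\dots,D_n$ are the patterns of the chambers in the half-circle $\{u\in\mathbb{S}^1:\langle x_k,u\rangle\ge0\}$ in counterclockwise order. With this listing, the random vector $(p(D_1),\dots,p(D_n))$ has the same distribution as $$\left(\frac12\,\frac{E_1}{\sum_{j=1}^nE_j},\ \dots,\ \frac12\,\frac{E_n}{\sum_{j=1}^nE_j}\right).$$ Moreover, for every listing $D_1,\dots,D_n,\bar D_1,\dots,\bar D_n$ of the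 $2n$ activation patterns (the order and the representatives of the pairs may depend on $X$ in any way), the two vectors have the same distribution up to permutation of the coordinates, that is, they lie in $S$ with the same probability for every permutation-invariant Borel set $S\subseteq\mathbb{R}^n$. (2) There are constants $C,K>0$, independent of $n$, such that for every $n\ge1$ and every such listing, with probability at least $1-e^{-20}-e^{-Cn}$ over $X$, $$\min_{1\le j\le n}\ \mathbb{P}_{u\sim\mathrm{Unif}(\mathbb{S}^1)}[\,1(Xu\ge 0)=D_j\,]\ \le\ \frac{K}{n^2}.$$ -/

import Mathlib

open MeasureTheory ProbabilityTheory

/-- The uniform distribution on the unit circle `S¹ ⊆ ℝ²`: normalized surface measure. -/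
noncomputable def circleUniform : Measure (Metric.sphere (0 : EuclideanSpace ℝ (Fin 2)) 1) :=
  ((volume : Measure (EuclideanSpace ℝ (Fin 2))).toSphere Set.univ)⁻¹ •
    (volume : Measure (EuclideanSpace ℝ (Fin 2))).toSphere

open Classical in
/-- The activation pattern `1(Xu ≥ 0)`, as a vector of `n` bits. -/
noncomputable def activationPattern {n : ℕ} (X : Matrix (Fin n) (Fin 2) ℝ)
    (u : EuclideanSpace ℝ (Fin 2)) : Fin n → Bool :=
  fun i => decide (0 ≤ X.mulVec u.ofLp i)

/-- The chamber of the pattern `D`: the unit vectors `u` with `1(Xu ≥ 0) = D`. -/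
def chamber {n : ℕ} (X : Matrix (Fin n) (Fin 2) ℝ) (D : Fin n → Bool) :
    Set (Metric.sphere (0 : EuclideanSpace ℝ (Fin 2)) 1) :=
  {u | activationPattern X (u : EuclideanSpace ℝ (Fin 2)) = D}

/-- The probability of `1(Xu ≥ 0) = D` when `u` is uniform on the unit circle. -/
noncomputable def chamberProb {n : ℕ} (X : Matrix (Fin n) (Fin 2) ℝ) (D : Fin n → Bool) : ℝ :=
  circleUniform.real (chamber X D)

/-- The complementary pattern. -/
def complPattern {n : ℕ} (D : Fin n → Bool) : Fin n → Bool := fun i => !(D i)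

/-- `D₁, …, Dₙ, D̄₁, …, D̄ₙ` lists, without repetition, exactly the patterns realized by some unit
vector. -/
def IsPairedEnumeration {n : ℕ} (X : Matrix (Fin n) (Fin 2) ℝ) (D : Fin n → Fin n → Bool) : Prop :=
  Set.BijOn (Sum.elim D fun j => complPattern (D j)) Set.univ {D' | (chamber X D').Nonempty}

/-- The paired enumeration in which `D₁, …, Dₙ` are the chambers of the half-circle
`{u | ⟨x_k, u⟩ ≥ 0}`, listed in counterclockwise order. (Two points of a closed half-circle come in
counterclockwise order when their determinant is nonnegative.) -/
def IsCounterclockwiseFrom {n : ℕ} (X : Matrix (Fin n) (Fin 2) ℝ) (k : Fin n)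
    (D : Fin n → Fin n → Bool) : Prop :=
  IsPairedEnumeration X D ∧ (∀ j, D j k = true) ∧
    ∀ i j, i < j → ∀ u ∈ chamber X (D i), ∀ v ∈ chamber X (D j),
      0 ≤ (u : EuclideanSpace ℝ (Fin 2)) 0 * (v : EuclideanSpace ℝ (Fin 2)) 1 -
        (u : EuclideanSpace ℝ (Fin 2)) 1 * (v : EuclideanSpace ℝ (Fin 2)) 0

/-- `X` is an `n × 2` random matrix with i.i.d. standard Gaussian entries. -/
def IsGaussianMatrix {Ω : Type*} [MeasurableSpace Ω] {n : ℕ}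
    (X : Ω → Matrix (Fin n) (Fin 2) ℝ) (P : Measure Ω) : Prop :=
  iIndepFun (fun (p : Fin n × Fin 2) (ω : Ω) => X ω p.1 p.2) P ∧
    ∀ i j, HasLaw (fun ω => X ω i j) (gaussianReal 0 1) P

/-- `E₁, …, Eₙ` are i.i.d. exponential random variables of rate `1`. -/
def IsIIDExp {Ω : Type*} [MeasurableSpace Ω] {n : ℕ} (E : Fin n → Ω → ℝ) (Q : Measure Ω) : Prop :=
  iIndepFun E Q ∧ ∀ i, HasLaw (E i) (expMeasure 1) Q

/-! The lines orthogonal to the rows cut the circle into arcs that come in antipodal pairs with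
complementary patterns. Measure position on the half-circle of row `k` by the fraction `t ∈ [0, 1]`
of a half-turn. The line of row `k` sits at `t = 0`, that of row `i` at the fractional part of `(θ i
- θ k) / π`, where `θ` denotes the arguments of the rows. A Gaussian row has uniform argument
(`map_planeAngle_gaussian`), so for each fixed `θ k` the other lines are independent uniform points
of `(0, 1)`, with a law not depending on `θ k` (`map_relAngles`). Hence the chamber probabilities
are half the spacings of `n - 1` sorted uniform points (`GenericRows.chamberProb_arcPattern`).

These spacings are distributed as normalized exponentials (`map_gaps_sorted_uniformPoints`). In the
linear coordinates (total `s`, partial sums `w`), the exponential density `e^{-s}` depends on `s`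
alone and the normalized vector on `w / s` alone. Integrating out `s` leaves a multiple of Lebesgue
measure on the simplex of increasing vectors (`exists_map_normalized_expPoints`). Sorting uniform
points also gives a multiple of it (`map_sorted_uniformPoints`). Two proportional probability
measures coincide, so no constant has to be evaluated.

An arbitrary paired listing differs from the counterclockwise one by a permutation and by replacing
some patterns with their complements. The latter does not change probabilities, whence the law up to
relabelling (`GenericRows.exists_perm_chamberProb`).

For the minimum, if every coordinate exceeds `K / n²` while `∑ E ≥ n / 2`, then every `E i` exceeds
`K / n`, which has probability `e^{-K}`. The event `∑ E < n / 2` is exponentially unlikely by a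
Chernoff bound (`map_halfNormalized_iInf_le`). -/

/-! ### Spacings as linear coordinates -/

theorem Fin.snoc_add_const {m : ℕ} (v w : Fin m → ℝ) (s t : ℝ) :
    (Fin.snoc (v + w) (s + t) : Fin (m + 1) → ℝ) =
      (Fin.snoc v s : Fin (m + 1) → ℝ) + (Fin.snoc w t : Fin (m + 1) → ℝ) := by
  ext j
  refine Fin.lastCases ?_ (fun i => ?_) j <;> simp

theorem Fin.snoc_smul_const {m : ℕ} (c : ℝ) (w : Fin m → ℝ) (s : ℝ) :
    (Fin.snoc (c • w) (c * s) : Fin (m + 1) → ℝ) = c • (Fin.snoc w s : Fin (m + 1) → ℝ) := by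
  ext j
  refine Fin.lastCases ?_ (fun i => ?_) j <;> simp

/-- The gaps `w₀ - 0, w₁ - w₀, …, s - wₘ₋₁` between consecutive entries of `0, w₀, …, wₘ₋₁, s`. -/
noncomputable def gaps (m : ℕ) : ℝ × (Fin m → ℝ) →ₗ[ℝ] (Fin (m + 1) → ℝ) where
  toFun p := (Fin.snoc p.2 p.1 : Fin (m + 1) → ℝ) - (Fin.cons 0 p.2 : Fin (m + 1) → ℝ)
  map_add' p q := by
    have h : (Fin.cons 0 (p.2 + q.2) : Fin (m + 1) → ℝ) =
        (Fin.cons 0 p.2 : Fin (m + 1) → ℝ) + (Fin.cons 0 q.2 : Fin (m + 1) → ℝ) := by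
      ext j
      refine Fin.cases ?_ (fun i => ?_) j <;> simp
    simp only [Prod.fst_add, Prod.snd_add, Fin.snoc_add_const, h]
    abel
  map_smul' c p := by
    have h : (Fin.cons 0 (c • p.2) : Fin (m + 1) → ℝ) = c • (Fin.cons 0 p.2 : Fin (m + 1) → ℝ) := by
      ext j
      refine Fin.cases ?_ (fun i => ?_) j <;> simp
    simp only [Prod.smul_fst, Prod.smul_snd, smul_eq_mul, Fin.snoc_smul_const, h,
      RingHom.id_apply, smul_sub]

theorem gaps_apply {m : ℕ} (s : ℝ) (w : Fin m → ℝ) (j : Fin (m + 1)) :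
    gaps m (s, w) j = (Fin.snoc w s : Fin (m + 1) → ℝ) j - (Fin.cons 0 w : Fin (m + 1) → ℝ) j :=
  rfl

theorem sum_gaps {m : ℕ} (s : ℝ) (w : Fin m → ℝ) : ∑ j, gaps m (s, w) j = s := by
  simp only [gaps_apply, Finset.sum_sub_distrib]
  rw [Fin.sum_univ_castSucc, Fin.sum_univ_succ (fun j => (Fin.cons 0 w : Fin (m + 1) → ℝ) j)]
  simp

theorem gaps_injective (m : ℕ) : Function.Injective (gaps m) := by
  rw [← LinearMap.ker_eq_bot, LinearMap.ker_eq_bot']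
  rintro ⟨s, w⟩ h
  have h0 : ∀ j, (Fin.cons 0 w : Fin (m + 1) → ℝ) j = 0 := by
    intro j
    induction j using Fin.induction with
    | zero => simp
    | succ i ih =>
      have := congrFun h i.castSucc
      rw [gaps_apply, ih] at this
      simpa using this
  have hw : w = 0 := by
    ext i
    simpa using h0 i.succ
  have hs := sum_gaps s w
  rw [h] at hs
  simp only [Pi.zero_apply, Finset.sum_const_zero] at hs
  simp [hw, ← hs]

/-- `gaps` as a linear isomorphism. -/
noncomputable def gapsEquiv (m : ℕ) : (ℝ × (Fin m → ℝ)) ≃L[ℝ] (Fin (m + 1) → ℝ) :=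
  ((gaps m).linearEquivOfInjective (gaps_injective m)
    (by simp [Module.finrank_prod, add_comm])).toContinuousLinearEquiv

theorem gapsEquiv_apply {m : ℕ} (p : ℝ × (Fin m → ℝ)) : gapsEquiv m p = gaps m p := rfl

theorem measurable_gaps (m : ℕ) : Measurable (gaps m) :=
  (gapsEquiv m).continuous.measurable

/-- The increasing vectors with entries in `(0, 1)`. -/
def orderSimplex (m : ℕ) : Set (Fin m → ℝ) := {w | StrictMono w ∧ ∀ j, w j ∈ Set.Ioo (0 : ℝ) 1}

/-- The gaps are the steps of the sequence `0, w₀, …, wₘ₋₁, 1`, which increases strictly exactly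
when all its steps are positive. -/
theorem gaps_one_pos_iff {m : ℕ} (w : Fin m → ℝ) :
    (∀ j, 0 < gaps m (1, w) j) ↔ w ∈ orderSimplex m := by
  simp only [gaps_apply, sub_pos]
  constructor
  · intro h
    have hb : StrictMono (Fin.cons 0 (Fin.snoc w 1 : Fin (m + 1) → ℝ) : Fin (m + 2) → ℝ) := by
      rw [Fin.strictMono_iff_lt_succ]
      intro j
      rw [Fin.cons_succ]
      refine lt_of_le_of_lt (le_of_eq ?_) (h j)
      rw [Fin.cons_snoc_eq_snoc_cons, Fin.snoc_castSucc]
    have hw : ∀ i, (Fin.cons 0 (Fin.snoc w 1 : Fin (m + 1) → ℝ) : Fin (m + 2) → ℝ)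
        i.castSucc.succ = w i := by intro i; simp
    refine ⟨fun i j hij => ?_, fun j => ⟨?_, ?_⟩⟩
    · rw [← hw, ← hw]
      exact hb (by simpa using hij)
    · rw [← hw]
      have := hb (Fin.succ_pos j.castSucc)
      rwa [Fin.cons_zero] at this
    · rw [← hw]
      have := hb (show j.castSucc.succ < (Fin.last m).succ by
        rw [Fin.succ_lt_succ_iff]
        exact Fin.castSucc_lt_last j)
      simpa using this
  · rintro ⟨hm, hw⟩ j
    refine Fin.lastCases ?_ (fun i => ?_) j
    · rw [Fin.snoc_last]
      refine Fin.cases ?_ (fun i => ?_) (Fin.last m)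
      · simp
      · simpa using (hw i).2
    · rw [Fin.snoc_castSucc]
      rcases Fin.eq_zero_or_eq_succ i.castSucc with h | ⟨i', h⟩
      · rw [h, Fin.cons_zero]
        exact (hw i).1
      · rw [h, Fin.cons_succ]
        apply hm
        have := congrArg Fin.val h
        simp only [Fin.val_castSucc, Fin.val_succ] at this
        exact Fin.lt_def.2 (by omega)

theorem gaps_smul_one {m : ℕ} {s : ℝ} (hs : s ≠ 0) (w : Fin m → ℝ) :
    gaps m (s, w) = s • gaps m (1, s⁻¹ • w) := by
  rw [← map_smul]
  congr 1
  simp [smul_smul, hs]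

/-- By homogeneity, the positive orthant is in the coordinates `(s, w)` a cone whose slice at height
`s` is the simplex scaled by `s`. -/
theorem gaps_pos_iff {m : ℕ} (s : ℝ) (w : Fin m → ℝ) :
    (∀ j, 0 < gaps m (s, w) j) ↔ 0 < s ∧ s⁻¹ • w ∈ orderSimplex m := by
  have key : 0 < s → ((∀ j, 0 < gaps m (s, w) j) ↔ s⁻¹ • w ∈ orderSimplex m) := by
    intro hs
    rw [gaps_smul_one hs.ne', ← gaps_one_pos_iff]
    refine forall_congr' fun j => ?_
    rw [Pi.smul_apply, smul_eq_mul, mul_pos_iff_of_pos_left hs]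
  constructor
  · intro h
    have hs : 0 < s := by
      rw [← sum_gaps s w]
      exact Finset.sum_pos (fun j _ => h j) Finset.univ_nonempty
    exact ⟨hs, (key hs).1 h⟩
  · rintro ⟨hs, h⟩
    exact (key hs).2 h

theorem measurableSet_orderSimplex (m : ℕ) : MeasurableSet (orderSimplex m) := by
  have : orderSimplex m = ⋂ j, {w | 0 < gaps m (1, w) j} := by
    ext w
    simp [← gaps_one_pos_iff]
  rw [this]
  refine MeasurableSet.iInter fun j => measurableSet_lt measurable_const ?_
  exact (measurable_pi_apply j).comp ((measurable_gaps m).comp measurable_prodMk_left)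

/-! ### Order statistics of uniform points -/

/-- The entries of a vector in increasing order. -/
noncomputable def sorted {m : ℕ} (w : Fin m → ℝ) : Fin m → ℝ := w ∘ Tuple.sort w

/-- The sorting permutation depends on `w`; a finite union over all permutations makes measurability
evident and reduces `map_sorted_uniformPoints` to a count of pieces. -/
theorem sorted_preimage {m : ℕ} (A : Set (Fin m → ℝ)) :
    sorted ⁻¹' A = ⋃ σ : Equiv.Perm (Fin m),
      (fun w : Fin m → ℝ => w ∘ σ) ⁻¹' ({w | Monotone w} ∩ A) := by
  ext w
  simp only [Set.mem_preimage, Set.mem_iUnion, Set.mem_inter_iff, Set.mem_ofPred_eq, sorted]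
  constructor
  · intro h
    exact ⟨_, Tuple.monotone_sort w, h⟩
  · rintro ⟨σ, h1, h2⟩
    rwa [← Tuple.comp_sort_eq_comp_iff_monotone.2 h1]

theorem measurable_comp_perm {m : ℕ} (σ : Equiv.Perm (Fin m)) :
    Measurable (fun w : Fin m → ℝ => w ∘ σ) :=
  measurable_pi_lambda _ fun i => measurable_pi_apply (σ i)

theorem measurableSet_monotone (m : ℕ) : MeasurableSet {w : Fin m → ℝ | Monotone w} := by
  have : {w : Fin m → ℝ | Monotone w} = ⋂ i, ⋂ j, ⋂ _ : i ≤ j, {w | w i ≤ w j} := by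
    ext w
    simp [Monotone]
  rw [this]
  exact MeasurableSet.iInter fun i => MeasurableSet.iInter fun j => MeasurableSet.iInter fun _ =>
    measurableSet_le (measurable_pi_apply i) (measurable_pi_apply j)

theorem measurable_sorted (m : ℕ) : Measurable (sorted (m := m)) := by
  intro A hA
  rw [sorted_preimage]
  exact MeasurableSet.iUnion fun σ =>
    measurable_comp_perm σ ((measurableSet_monotone m).inter hA)

theorem volume_ae_injective (m : ℕ) : ∀ᵐ w : Fin m → ℝ, Function.Injective w := by
  have h : ∀ i j : Fin m, i ≠ j → ∀ᵐ w : Fin m → ℝ, w i ≠ w j := by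
    intro i j hij
    let L : (Fin m → ℝ) →ₗ[ℝ] ℝ := LinearMap.proj (R := ℝ) (φ := fun _ => ℝ) i - LinearMap.proj j
    have hL : LinearMap.ker L ≠ ⊤ := by
      intro h
      have : Pi.single i (1 : ℝ) ∈ LinearMap.ker L := h ▸ Submodule.mem_top
      simp [L, hij.symm] at this
    have := Measure.addHaar_submodule (volume : Measure (Fin m → ℝ)) _ hL
    filter_upwards [measure_eq_zero_iff_ae_notMem.1 this] with w hw hc
    exact hw (by simp [L, hc])
  have h' : ∀ᵐ w : Fin m → ℝ, ∀ i j : Fin m, i ≠ j → w i ≠ w j := by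
    simp only [ae_all_iff]
    exact h
  filter_upwards [h'] with w hw i j hij
  by_contra hne
  exact hw i j hne hij

/-- The law of `m` independent uniform points of `(0, 1)`. -/
noncomputable def uniformPoints (m : ℕ) : Measure (Fin m → ℝ) :=
  Measure.pi fun _ => (volume : Measure ℝ).restrict (Set.Ioo 0 1)

theorem uniformPoints_eq (m : ℕ) :
    uniformPoints m = (volume : Measure (Fin m → ℝ)).restrict (Set.pi Set.univ fun _ => Set.Ioo 0 1) := by
  rw [uniformPoints, volume_pi, Measure.restrict_pi_pi]

instance isProbabilityMeasure_uniformPoints (m : ℕ) : IsProbabilityMeasure (uniformPoints m) := by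
  constructor
  rw [uniformPoints, Measure.pi_univ]
  simp

theorem uniformPoints_ae (m : ℕ) : ∀ᵐ w ∂uniformPoints m,
    Function.Injective w ∧ ∀ j, w j ∈ Set.Ioo (0 : ℝ) 1 := by
  rw [uniformPoints_eq]
  refine (ae_restrict_of_ae (volume_ae_injective m)).and ?_
  filter_upwards [ae_restrict_mem (MeasurableSet.univ_pi fun _ => measurableSet_Ioo)] with w hw
  simpa using hw

theorem map_comp_perm_uniformPoints {m : ℕ} (σ : Equiv.Perm (Fin m)) :
    (uniformPoints m).map (fun w => w ∘ σ) = uniformPoints m := by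
  have := measurePreserving_piCongrLeft (α := fun _ : Fin m => ℝ)
    (fun _ => (volume : Measure ℝ).restrict (Set.Ioo 0 1)) σ.symm
  refine Eq.trans (congrArg (fun f => Measure.map f _) ?_) this.map_eq
  ext w i
  obtain ⟨j, rfl⟩ := σ.symm.surjective i
  simp [MeasurableEquiv.piCongrLeft_apply_apply]

/-- Up to the null set of vectors with repeated entries, the cube is a disjoint union of `m!`
regions, one per ordering, each carried onto the simplex by a volume-preserving permutation of
coordinates. -/
theorem map_sorted_uniformPoints (m : ℕ) :
    (uniformPoints m).map sorted =
      (Fintype.card (Equiv.Perm (Fin m)) : ENNReal) • volume.restrict (orderSimplex m) := by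
  ext A hA
  rw [Measure.map_apply (measurable_sorted m) hA, sorted_preimage,
    measure_iUnion₀, tsum_fintype]
  · have h : ∀ σ : Equiv.Perm (Fin m),
        uniformPoints m ((fun w : Fin m → ℝ => w ∘ σ) ⁻¹' ({w | Monotone w} ∩ A)) =
          volume.restrict (orderSimplex m) A := by
      intro σ
      rw [← Measure.map_apply (measurable_comp_perm σ) ((measurableSet_monotone m).inter hA),
        map_comp_perm_uniformPoints, uniformPoints_eq,
        Measure.restrict_apply ((measurableSet_monotone m).inter hA), Measure.restrict_apply hA]
      refine measure_congr ?_
      filter_upwards [volume_ae_injective m] with w hw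
      apply propext
      change (Monotone w ∧ w ∈ A) ∧ w ∈ Set.pi Set.univ _ ↔ w ∈ A ∧ w ∈ orderSimplex m
      simp only [orderSimplex, Set.mem_ofPred_eq, Set.mem_pi, Set.mem_univ, true_imp_iff]
      constructor
      · rintro ⟨⟨h1, h2⟩, h3⟩
        exact ⟨h2, h1.strictMono_of_injective hw, h3⟩
      · rintro ⟨h2, h1, h3⟩
        exact ⟨⟨h1.monotone, h2⟩, h3⟩
    simp only [h, Finset.sum_const, Finset.card_univ, Measure.smul_apply, nsmul_eq_mul, smul_eq_mul]
  · intro σ τ hst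
    refine measure_mono_null (t := {w | ¬ Function.Injective w}) ?_ ?_
    · rintro w ⟨⟨h1, -⟩, ⟨h2, -⟩⟩ hinj
      apply hst
      have := Tuple.unique_monotone h1 h2
      ext i
      exact congrArg Fin.val (hinj (congrFun this i))
    · exact ae_iff.1 ((uniformPoints_ae m).mono fun w hw => hw.1)
  · intro σ
    exact (measurable_comp_perm σ ((measurableSet_monotone m).inter hA)).nullMeasurableSet

/-! ### Independent exponentials and their normalization -/

theorem lintegral_pi_prod {n : ℕ} (μ : Measure ℝ) [SigmaFinite μ] (f : Fin n → ℝ → ENNReal)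
    (hf : ∀ i, Measurable (f i)) :
    ∫⁻ x : Fin n → ℝ, ∏ i, f i (x i) ∂(Measure.pi fun _ => μ) = ∏ i, ∫⁻ x, f i x ∂μ := by
  induction n with
  | zero => simp
  | succ n ih =>
    have h := measurePreserving_piFinSuccAbove (fun _ : Fin (n + 1) => μ) 0
    rw [← h.symm.lintegral_comp_emb (MeasurableEquiv.measurableEmbedding _), Fin.prod_univ_succ,
      ← ih _ fun i => hf i.succ, ← lintegral_prod_mul]
    · refine lintegral_congr fun p => ?_
      rw [Fin.prod_univ_succ]
      simp [MeasurableEquiv.piFinSuccAbove]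
    · exact (hf 0).aemeasurable
    · exact (Finset.measurable_prod _ fun i _ =>
        (hf i.succ).comp (measurable_pi_apply i)).aemeasurable

theorem pi_withDensity {n : ℕ} (f : ℝ → ENNReal) (hf : Measurable f)
    [SigmaFinite ((volume : Measure ℝ).withDensity f)] :
    Measure.pi (fun _ : Fin n => (volume : Measure ℝ).withDensity f) =
      (volume : Measure (Fin n → ℝ)).withDensity fun x => ∏ i, f (x i) := by
  refine Measure.pi_eq fun s hs => ?_
  rw [withDensity_apply _ (MeasurableSet.univ_pi hs), ← lintegral_indicator (MeasurableSet.univ_pi hs)]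
  have h : ∀ x : Fin n → ℝ, (Set.univ.pi s).indicator (fun x => ∏ i, f (x i)) x =
      ∏ i, (s i).indicator f (x i) := by
    intro x
    by_cases hx : x ∈ Set.univ.pi s
    · rw [Set.indicator_of_mem hx]
      exact Finset.prod_congr rfl fun i _ => (Set.indicator_of_mem (hx i trivial) _).symm
    · rw [Set.indicator_of_notMem hx]
      simp only [Set.mem_pi, Set.mem_univ, true_imp_iff, not_forall] at hx
      obtain ⟨i, hi⟩ := hx
      exact (Finset.prod_eq_zero (Finset.mem_univ i) (Set.indicator_of_notMem hi _)).symm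
  simp only [h]
  rw [volume_pi, lintegral_pi_prod volume _ fun i => hf.indicator (hs i)]
  refine Finset.prod_congr rfl fun i _ => ?_
  rw [lintegral_indicator (hs i), withDensity_apply _ (hs i)]

/-- The standard exponential density, supported on the open half-line. -/
noncomputable def expDensity (x : ℝ) : ENNReal := if 0 < x then ENNReal.ofReal (Real.exp (-x)) else 0

theorem measurable_expDensity : Measurable expDensity :=
  Measurable.ite measurableSet_Ioi (by fun_prop) measurable_const

/-- The densities differ only at the null point `0`; dropping it makes positivity strict, as
`gaps_pos_iff` requires. -/
theorem expMeasure_one_eq : expMeasure 1 = (volume : Measure ℝ).withDensity expDensity := by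
  rw [expMeasure, gammaMeasure]
  refine withDensity_congr_ae ?_
  filter_upwards [Measure.ae_ne (volume : Measure ℝ) 0] with x hx
  change exponentialPDF 1 x = _
  rw [exponentialPDF_eq, expDensity]
  by_cases h : 0 < x
  · simp [h, h.le]
  · simp [h, not_le.2 (lt_of_le_of_ne (not_lt.1 h) hx)]

theorem prod_expDensity {n : ℕ} (x : Fin n → ℝ) :
    ∏ i, expDensity (x i) = if ∀ i, 0 < x i then ENNReal.ofReal (Real.exp (-∑ i, x i)) else 0 := by
  split_ifs with h
  · rw [← Finset.sum_neg_distrib, Real.exp_sum, ENNReal.ofReal_prod_of_nonneg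
      fun i _ => (Real.exp_pos _).le]
    exact Finset.prod_congr rfl fun i _ => if_pos (h i)
  · push Not at h
    obtain ⟨i, hi⟩ := h
    exact Finset.prod_eq_zero (Finset.mem_univ i) (if_neg hi.not_gt)

/-- The law of `n` independent standard exponential variables. -/
noncomputable def expPoints (n : ℕ) : Measure (Fin n → ℝ) := Measure.pi fun _ => expMeasure 1

instance : IsProbabilityMeasure (expMeasure 1) := isProbabilityMeasure_expMeasure one_pos

instance isProbabilityMeasure_expPoints (n : ℕ) : IsProbabilityMeasure (expPoints n) := by
  unfold expPoints; infer_instance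

theorem expPoints_eq (n : ℕ) : expPoints n = (volume : Measure (Fin n → ℝ)).withDensity
    fun x => if ∀ i, 0 < x i then ENNReal.ofReal (Real.exp (-∑ i, x i)) else 0 := by
  have : SigmaFinite ((volume : Measure ℝ).withDensity expDensity) := by
    rw [← expMeasure_one_eq]; infer_instance
  simp only [expPoints, expMeasure_one_eq, pi_withDensity _ measurable_expDensity, prod_expDensity]

/-- The coordinates divided by their sum. -/
noncomputable def normalized {n : ℕ} (x : Fin n → ℝ) : Fin n → ℝ := fun j => x j / ∑ i, x i

theorem measurable_normalized (n : ℕ) : Measurable (normalized (n := n)) :=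
  measurable_pi_lambda _ fun j => (measurable_pi_apply j).div
    (Finset.measurable_sum _ fun i _ => measurable_pi_apply i)

theorem normalized_gaps {m : ℕ} {s : ℝ} (hs : 0 < s) (w : Fin m → ℝ) :
    normalized (gaps m (s, w)) = gaps m (1, s⁻¹ • w) := by
  ext j
  rw [normalized, sum_gaps, gaps_smul_one hs.ne', Pi.smul_apply, smul_eq_mul]
  field_simp

theorem measurable_gaps_one (m : ℕ) : Measurable fun w => gaps m (1, w) :=
  (measurable_gaps m).comp measurable_prodMk_left

theorem exists_map_normalized_expPoints (m : ℕ) : ∃ c : ENNReal,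
    (expPoints (m + 1)).map normalized =
      c • (volume.restrict (orderSimplex m)).map fun w => gaps m (1, w) := by
  have hP : (volume : Measure (ℝ × (Fin m → ℝ))).IsAddHaarMeasure := by
    rw [Measure.volume_eq_prod]; infer_instance
  have hH := (gapsEquiv m).isAddHaarMeasure_map (volume : Measure (ℝ × (Fin m → ℝ)))
  have hvol := Measure.isAddLeftInvariant_eq_smul (volume : Measure (Fin (m + 1) → ℝ))
    ((volume : Measure (ℝ × (Fin m → ℝ))).map (gapsEquiv m))
  set c₀ := Measure.addHaarScalarFactor (volume : Measure (Fin (m + 1) → ℝ))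
    ((volume : Measure (ℝ × (Fin m → ℝ))).map (gapsEquiv m))
  -- `c₀` is the constant by which the linear map `gapsEquiv` changes volume; `|s ^ m|` is the
  -- Jacobian of scaling the slice at height `s` to the simplex.
  refine ⟨c₀ * ∫⁻ s in Set.Ioi (0 : ℝ), ENNReal.ofReal (Real.exp (-s)) *
    ENNReal.ofReal |(s ^ m)|, ?_⟩
  have hpos : MeasurableSet {x : Fin (m + 1) → ℝ | ∀ i, 0 < x i} := by
    simp only [Set.ofPred_forall]
    exact MeasurableSet.iInter fun i => measurableSet_lt measurable_const (measurable_pi_apply i)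
  have hdens : Measurable fun x : Fin (m + 1) → ℝ =>
      if ∀ i, 0 < x i then ENNReal.ofReal (Real.exp (-∑ i, x i)) else 0 :=
    Measurable.ite hpos (by fun_prop) measurable_const
  ext A hA
  have hA' := measurable_normalized (m + 1) hA
  set B := (fun w => gaps m (1, w)) ⁻¹' A ∩ orderSimplex m with hB
  have hBm : MeasurableSet B := (measurable_gaps_one m hA).inter (measurableSet_orderSimplex m)
  rw [Measure.map_apply (measurable_normalized _) hA, expPoints_eq, withDensity_apply _ hA',
    hvol, ← lintegral_indicator hA']
  rw [show ∀ (μ : Measure (Fin (m + 1) → ℝ)), c₀ • μ = (c₀ : ENNReal) • μ from fun _ => rfl,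
    lintegral_smul_measure, lintegral_map (hdens.indicator hA') (gapsEquiv m).continuous.measurable]
  rw [Measure.smul_apply, Measure.map_apply (measurable_gaps_one m) hA,
    Measure.restrict_apply (measurable_gaps_one m hA), ← hB, smul_eq_mul, smul_eq_mul, mul_assoc]
  congr 1
  -- In the coordinates `(s, w)` the integrand is `e^{-s}` times the indicator of `w ∈ s • B`, so
  -- the inner integral over `w` is `s ^ m` times the volume of `B`.
  have key : ∀ p : ℝ × (Fin m → ℝ), (normalized ⁻¹' A).indicator
      (fun x => if ∀ i, 0 < x i then ENNReal.ofReal (Real.exp (-∑ i, x i)) else 0)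
        (gapsEquiv m p) = (Set.Ioi (0 : ℝ)).indicator (fun s => ENNReal.ofReal (Real.exp (-s)) *
          ((fun w => s⁻¹ • w) ⁻¹' B).indicator 1 p.2) p.1 := by
    rintro ⟨s, w⟩
    rw [gapsEquiv_apply]
    by_cases hs : 0 < s
    · rw [Set.indicator_of_mem (show s ∈ Set.Ioi (0 : ℝ) from hs)]
      by_cases hw : s⁻¹ • w ∈ orderSimplex m
      · have h1 := (gaps_pos_iff s w).2 ⟨hs, hw⟩
        by_cases hwA : gaps m (1, s⁻¹ • w) ∈ A
        · rw [Set.indicator_of_mem, if_pos h1, sum_gaps, Set.indicator_of_mem]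
          · simp
          · exact ⟨hwA, hw⟩
          · rwa [Set.mem_preimage, normalized_gaps hs]
        · rw [Set.indicator_of_notMem, Set.indicator_of_notMem, mul_zero]
          · exact fun h => hwA h.1
          · rwa [Set.mem_preimage, normalized_gaps hs]
      · have h1 : ¬ ∀ j, 0 < gaps m (s, w) j := fun h => hw ((gaps_pos_iff s w).1 h).2
        rw [Set.indicator_of_notMem (s := (fun w => s⁻¹ • w) ⁻¹' B) (fun h => hw h.2), mul_zero]
        refine Set.indicator_apply_eq_zero.2 fun _ => if_neg h1
    · rw [Set.indicator_of_notMem (show s ∉ Set.Ioi (0 : ℝ) from hs)]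
      refine Set.indicator_apply_eq_zero.2 fun _ => if_neg fun h => hs ((gaps_pos_iff s w).1 h).1
  simp only [key]
  have hmeas : Measurable fun p : ℝ × (Fin m → ℝ) => (Set.Ioi (0 : ℝ)).indicator
      (fun s => ENNReal.ofReal (Real.exp (-s)) *
          ((fun w => s⁻¹ • w) ⁻¹' B).indicator 1 p.2) p.1 := by
    have := (hdens.indicator hA').comp (gapsEquiv m).continuous.measurable
    convert this using 1
    ext p
    exact (key p).symm
  rw [Measure.volume_eq_prod, lintegral_prod _ hmeas.aemeasurable, ← lintegral_mul_const]
  swap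
  · fun_prop
  rw [← lintegral_indicator measurableSet_Ioi]
  refine lintegral_congr fun s => ?_
  by_cases hs : s ∈ Set.Ioi (0 : ℝ)
  · simp only [Set.indicator_of_mem hs]
    have hs' : (0 : ℝ) < s := hs
    rw [lintegral_const_mul _ (measurable_one.indicator ((measurable_const_smul _) hBm)),
      lintegral_indicator_one ((measurable_const_smul _) hBm),
      Measure.addHaar_preimage_smul _ (inv_ne_zero hs'.ne'), mul_assoc]
    simp
  · simp only [Set.indicator_of_notMem hs, lintegral_zero]

/-- Both sides are multiples of one measure, the image of Lebesgue measure on the simplex, and both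
have total mass one, which forces the factors to agree. -/
theorem map_gaps_sorted_uniformPoints (m : ℕ) :
    (uniformPoints m).map (fun w => gaps m (1, sorted w)) =
      (expPoints (m + 1)).map normalized := by
  obtain ⟨c, hc⟩ := exists_map_normalized_expPoints m
  have h1 : (uniformPoints m).map (fun w => gaps m (1, sorted w)) =
      (Fintype.card (Equiv.Perm (Fin m)) : ENNReal) •
        (volume.restrict (orderSimplex m)).map fun w => gaps m (1, w) := by
    rw [← Measure.map_smul, ← map_sorted_uniformPoints,
      Measure.map_map (measurable_gaps_one m) (measurable_sorted m)]
    rfl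
  have p1 : IsProbabilityMeasure ((uniformPoints m).map (fun w => gaps m (1, sorted w))) :=
    Measure.isProbabilityMeasure_map
      ((measurable_gaps_one m).comp (measurable_sorted m)).aemeasurable
  have p2 : IsProbabilityMeasure ((expPoints (m + 1)).map normalized) :=
    Measure.isProbabilityMeasure_map (measurable_normalized _).aemeasurable
  have e1 := p1.measure_univ
  have e2 := p2.measure_univ
  rw [h1, Measure.smul_apply, smul_eq_mul] at e1
  rw [hc, Measure.smul_apply, smul_eq_mul] at e2
  rw [h1, hc, ENNReal.eq_inv_of_mul_eq_one_left e1, ENNReal.eq_inv_of_mul_eq_one_left e2]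

/-! ### Polar coordinates: the Gaussian direction and the uniform circle -/

theorem lintegral_polar_mul {f : ℝ × ℝ → ENNReal} {g h : ℝ → ENNReal} (hg : Measurable g)
    (hh : Measurable h)
    (hf : ∀ r θ, 0 < r → θ ∈ Set.Ioo (-Real.pi) Real.pi →
      f (r * Real.cos θ, r * Real.sin θ) = g r * h θ) :
    ∫⁻ p, f p = (∫⁻ r in Set.Ioi (0 : ℝ), ENNReal.ofReal r * g r) *
      ∫⁻ θ in Set.Ioo (-Real.pi) Real.pi, h θ := by
  rw [← lintegral_comp_polarCoord_symm, ← lintegral_prod_mul (by fun_prop) hh.aemeasurable,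
    Measure.prod_restrict, ← Measure.volume_eq_prod]
  refine setLIntegral_congr_fun polarCoord.open_target.measurableSet ?_
  rintro ⟨r, θ⟩ ⟨hr, hθ⟩
  simp only [polarCoord_symm_apply, smul_eq_mul]
  rw [hf r θ hr hθ, mul_assoc]

/-- The argument of the vector `(p.1, p.2)` in `(-π, π]`. -/
noncomputable def planeAngle (p : ℝ × ℝ) : ℝ := Complex.arg ⟨p.1, p.2⟩

theorem measurable_planeAngle : Measurable planeAngle := by
  refine Complex.measurable_arg.comp ?_
  exact Complex.measurableEquivRealProd.symm.measurable

theorem planeAngle_polar {r θ : ℝ} (hr : 0 < r) (hθ : θ ∈ Set.Ioo (-Real.pi) Real.pi) :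
    planeAngle (r * Real.cos θ, r * Real.sin θ) = θ := by
  refine Eq.trans ?_ (Complex.arg_mul_cos_add_sin_mul_I hr (Set.Ioo_subset_Ioc_self hθ))
  rw [planeAngle]
  congr 1
  apply Complex.ext <;> simp [← Complex.ofReal_cos, ← Complex.ofReal_sin]

/-- The uniform law on `(-π, π)`. -/
noncomputable def uniformAngle : Measure ℝ :=
  (ENNReal.ofReal (2 * Real.pi))⁻¹ • volume.restrict (Set.Ioo (-Real.pi) Real.pi)

/-- Normalization determines `c`, so radial integrals can stay unevaluated. -/
theorem eq_uniformAngle_of_eq_smul {μ : Measure ℝ} [IsProbabilityMeasure μ] {c : ENNReal}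
    (h : μ = c • volume.restrict (Set.Ioo (-Real.pi) Real.pi)) : μ = uniformAngle := by
  have h1 : μ Set.univ = 1 := measure_univ
  rw [h, Measure.smul_apply, smul_eq_mul, Measure.restrict_apply_univ, Real.volume_Ioo,
    show Real.pi - -Real.pi = 2 * Real.pi by ring] at h1
  rw [h, uniformAngle, ENNReal.eq_inv_of_mul_eq_one_left h1]

instance : IsProbabilityMeasure uniformAngle := by
  constructor
  rw [uniformAngle, Measure.smul_apply, smul_eq_mul, Measure.restrict_apply_univ, Real.volume_Ioo,
    show Real.pi - -Real.pi = 2 * Real.pi by ring]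
  exact ENNReal.inv_mul_cancel (by simp [Real.pi_pos]) ENNReal.ofReal_ne_top

/-- The joint density of two independent standard Gaussians depends on the radius alone, so it
factors in polar coordinates with a constant angular part. -/
theorem map_planeAngle_gaussian :
    ((gaussianReal 0 1).prod (gaussianReal 0 1)).map planeAngle = uniformAngle := by
  have : IsProbabilityMeasure (((gaussianReal 0 1).prod (gaussianReal 0 1)).map planeAngle) :=
    Measure.isProbabilityMeasure_map measurable_planeAngle.aemeasurable
  refine eq_uniformAngle_of_eq_smul (c := ∫⁻ r in Set.Ioi (0 : ℝ), ENNReal.ofReal r *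
    ENNReal.ofReal ((2 * Real.pi)⁻¹ * Real.exp (-r ^ 2 / 2))) ?_
  ext A hA
  rw [Measure.map_apply measurable_planeAngle hA, gaussianReal_of_var_ne_zero _ one_ne_zero,
    prod_withDensity (measurable_gaussianPDF _ _) (measurable_gaussianPDF _ _),
    withDensity_apply _ (measurable_planeAngle hA),
    ← lintegral_indicator (measurable_planeAngle hA), ← Measure.volume_eq_prod,
    lintegral_polar_mul (h := A.indicator 1)
      (g := fun r => ENNReal.ofReal ((2 * Real.pi)⁻¹ * Real.exp (-r ^ 2 / 2))) (by fun_prop) (measurable_one.indicator hA),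
    lintegral_indicator_one hA, Measure.smul_apply, smul_eq_mul]
  intro r θ hr hθ
  by_cases hA' : θ ∈ A
  · rw [Set.indicator_of_mem (by rwa [Set.mem_preimage, planeAngle_polar hr hθ]),
      Set.indicator_of_mem hA', Pi.one_apply, mul_one, gaussianPDF, gaussianPDF,
      ← ENNReal.ofReal_mul (gaussianPDFReal_nonneg _ _ _)]
    congr 1
    simp only [gaussianPDFReal, NNReal.coe_one, mul_one, sub_zero]
    rw [mul_mul_mul_comm, ← mul_inv, Real.mul_self_sqrt (by positivity), ← Real.exp_add]
    congr 2
    linear_combination (-r ^ 2 / 2) * Real.sin_sq_add_cos_sq θ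
  · rw [Set.indicator_of_notMem (by rwa [Set.mem_preimage, planeAngle_polar hr hθ]),
      Set.indicator_of_notMem hA', mul_zero]

/-- The point of the unit circle at angle `θ`. -/
noncomputable def circlePoint (θ : ℝ) : Metric.sphere (0 : EuclideanSpace ℝ (Fin 2)) 1 :=
  ⟨WithLp.toLp 2 ![Real.cos θ, Real.sin θ], by
    simp [EuclideanSpace.norm_eq, Fin.sum_univ_two]⟩

theorem circlePoint_zero (θ : ℝ) : (circlePoint θ : EuclideanSpace ℝ (Fin 2)) 0 = Real.cos θ := rfl

theorem circlePoint_one (θ : ℝ) : (circlePoint θ : EuclideanSpace ℝ (Fin 2)) 1 = Real.sin θ := rfl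

theorem measurable_circlePoint : Measurable circlePoint := by
  refine Measurable.subtype_mk ?_
  refine (PiLp.volume_preserving_toLp (Fin 2)).measurable.comp ?_
  refine measurable_pi_lambda _ fun i => ?_
  fin_cases i
  · exact Real.measurable_cos
  · exact Real.measurable_sin

-- `toSphere` is defined by the volume of the cone over `A`; describing the cone by norm and
-- direction gives its measurability and its polar form.
open scoped Pointwise in
theorem Ioo_smul_image_sphere {E : Type*} [NormedAddCommGroup E] [NormedSpace ℝ E]
    (A : Set (Metric.sphere (0 : E) 1)) :
    Set.Ioo (0 : ℝ) 1 • (Subtype.val '' A) =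
      {x : E | ‖x‖ ∈ Set.Ioo (0 : ℝ) 1 ∧ ‖x‖⁻¹ • x ∈ Subtype.val '' A} := by
  ext x
  constructor
  · rintro ⟨r, hr, _, ⟨a, ha, rfl⟩, rfl⟩
    have hn : ‖r • (a : E)‖ = r := by
      rw [norm_smul, norm_eq_of_mem_sphere, mul_one, Real.norm_of_nonneg hr.1.le]
    refine ⟨by rwa [hn], a, ha, ?_⟩
    change (a : E) = ‖r • (a : E)‖⁻¹ • r • (a : E)
    rw [hn, smul_smul, inv_mul_cancel₀ hr.1.ne', one_smul]
  · rintro ⟨h1, h2⟩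
    refine ⟨‖x‖, h1, _, h2, ?_⟩
    change ‖x‖ • ‖x‖⁻¹ • x = x
    rw [smul_smul, mul_inv_cancel₀ h1.1.ne', one_smul]

instance : IsProbabilityMeasure circleUniform := by
  constructor
  rw [circleUniform, Measure.smul_apply, smul_eq_mul]
  refine ENNReal.inv_mul_cancel ?_ (measure_ne_top _ _)
  rw [Measure.measure_univ_ne_zero]
  exact Measure.toSphere_ne_zero _

open scoped Pointwise in
theorem exists_toSphere_eq : ∃ c : ENNReal,
    ∀ A, MeasurableSet A → (volume : Measure (EuclideanSpace ℝ (Fin 2))).toSphere A =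
      c * volume (circlePoint ⁻¹' A ∩ Set.Ioo (-Real.pi) Real.pi) := by
  -- The `2` is the dimension factor in `toSphere`, and the integral is the radial part of the cone,
  -- cut off at `r < 1`.
  refine ⟨2 * ∫⁻ r in Set.Ioi (0 : ℝ), ENNReal.ofReal r * (Set.Iio (1 : ℝ)).indicator 1 r,
    fun A hA => ?_⟩
  have hA' : MeasurableSet ((↑) '' A : Set (EuclideanSpace ℝ (Fin 2))) :=
    (MeasurableEmbedding.subtype_coe Metric.isClosed_sphere.measurableSet).measurableSet_image.2 hA
  have hT : MeasurableSet (Set.Ioo (0 : ℝ) 1 • ((↑) '' A : Set (EuclideanSpace ℝ (Fin 2)))) := by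
    rw [Ioo_smul_image_sphere]
    exact (measurable_norm measurableSet_Ioo).inter
      ((measurable_norm.inv.smul measurable_id) hA')
  have hmp : MeasurePreserving
      (fun p : ℝ × ℝ => (WithLp.toLp 2 ((MeasurableEquiv.finTwoArrow (α := ℝ)).symm p) :
        EuclideanSpace ℝ (Fin 2))) volume volume :=
    (PiLp.volume_preserving_toLp (Fin 2)).comp (volume_preserving_finTwoArrow ℝ).symm
  rw [Measure.toSphere_apply' _ hA, ← hmp.measure_preimage hT.nullMeasurableSet,
    ← lintegral_indicator_one (hmp.measurable hT),
    lintegral_polar_mul (g := (Set.Iio (1 : ℝ)).indicator 1) (h := (circlePoint ⁻¹' A).indicator 1)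
      (measurable_one.indicator measurableSet_Iio)
      (measurable_one.indicator (measurable_circlePoint hA)),
    lintegral_indicator_one (measurable_circlePoint hA),
    Measure.restrict_apply (measurable_circlePoint hA), ← mul_assoc]
  · simp
  intro r θ hr hθ
  have hpt : (WithLp.toLp 2 ((MeasurableEquiv.finTwoArrow (α := ℝ)).symm
      (r * Real.cos θ, r * Real.sin θ)) : EuclideanSpace ℝ (Fin 2)) =
        r • (circlePoint θ : EuclideanSpace ℝ (Fin 2)) := by
    ext i
    fin_cases i <;> rfl
  have hn : ‖r • (circlePoint θ : EuclideanSpace ℝ (Fin 2))‖ = r := by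
    rw [norm_smul, norm_eq_of_mem_sphere, mul_one, Real.norm_of_nonneg hr.le]
  have hiff : (r * Real.cos θ, r * Real.sin θ) ∈
      (fun p : ℝ × ℝ => (WithLp.toLp 2 ((MeasurableEquiv.finTwoArrow (α := ℝ)).symm p) :
        EuclideanSpace ℝ (Fin 2))) ⁻¹' (Set.Ioo (0 : ℝ) 1 • ((↑) '' A)) ↔
      r ∈ Set.Iio 1 ∧ θ ∈ circlePoint ⁻¹' A := by
    rw [Set.mem_preimage, hpt, Ioo_smul_image_sphere, Set.mem_ofPred_eq, hn, smul_smul,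
      inv_mul_cancel₀ hr.ne', one_smul, Subtype.val_injective.mem_set_image]
    simp [hr]
  by_cases h1 : r ∈ Set.Iio (1 : ℝ)
  · by_cases h2 : θ ∈ circlePoint ⁻¹' A
    · rw [Set.indicator_of_mem (hiff.2 ⟨h1, h2⟩), Set.indicator_of_mem h1, Set.indicator_of_mem h2]
      simp
    · rw [Set.indicator_of_notMem fun h => h2 (hiff.1 h).2, Set.indicator_of_notMem h2, mul_zero]
  · rw [Set.indicator_of_notMem fun h => h1 (hiff.1 h).1, Set.indicator_of_notMem h1, zero_mul]

theorem circleUniform_apply {A : Set (Metric.sphere (0 : EuclideanSpace ℝ (Fin 2)) 1)}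
    (hA : MeasurableSet A) : circleUniform A = (ENNReal.ofReal (2 * Real.pi))⁻¹ *
      volume (circlePoint ⁻¹' A ∩ Set.Ioo (-Real.pi) Real.pi) := by
  obtain ⟨c, hc⟩ := exists_toSphere_eq
  have h : ∀ A, MeasurableSet A → circleUniform A =
      ((volume : Measure (EuclideanSpace ℝ (Fin 2))).toSphere Set.univ)⁻¹ * c *
        volume (circlePoint ⁻¹' A ∩ Set.Ioo (-Real.pi) Real.pi) := by
    intro A hA
    rw [circleUniform, Measure.smul_apply, smul_eq_mul, hc A hA, mul_assoc]
  have h1 : circleUniform Set.univ = 1 := measure_univ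
  rw [h _ MeasurableSet.univ, Set.preimage_univ, Set.univ_inter, Real.volume_Ioo,
    show Real.pi - -Real.pi = 2 * Real.pi by ring] at h1
  rw [h A hA, ENNReal.eq_inv_of_mul_eq_one_left h1]

/-! ### Angles modulo a half-turn and the law of the lines -/

/-- Every interval of length one period is a fundamental domain for the translations by multiples of
`T`. -/
theorem volume_inter_Ioo_of_periodic {S : Set ℝ} (hS : MeasurableSet S) {T : ℝ} (hT : 0 < T)
    (hper : ∀ x, x + T ∈ S ↔ x ∈ S) (a b : ℝ) :
    volume (S ∩ Set.Ioo a (a + T)) = volume (S ∩ Set.Ioo b (b + T)) := by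
  have h : ∀ g : AddSubgroup.zmultiples T, (fun x => g +ᵥ x) ⁻¹' S = S := by
    rintro ⟨g, n, rfl⟩
    ext x
    have hp : Function.Periodic (fun x => x ∈ S) T := fun x => propext (hper x)
    have := hp.zsmul n x
    simp only [eq_iff_iff] at this
    rw [← this, add_comm]
    rfl
  have h1 : ∀ c, volume (S ∩ Set.Ioo c (c + T)) = volume (S ∩ Set.Ioc c (c + T)) := fun c =>
    measure_congr ((Filter.EventuallyEq.refl _ S).inter Ioo_ae_eq_Ioc)
  rw [h1, h1]
  exact (isAddFundamentalDomain_Ioc hT a).measure_set_eq (isAddFundamentalDomain_Ioc hT b) hS h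

theorem volume_preimage_sub_div {p : ℝ} (hp : 0 < p) (a : ℝ) (B : Set ℝ) :
    volume ((fun t => (t - a) / p) ⁻¹' B) = ENNReal.ofReal p * volume B := by
  have : (fun t => (t - a) / p) ⁻¹' B = (fun t => t + -a) ⁻¹' ((fun t => t * p⁻¹) ⁻¹' B) := by
    ext t; simp [sub_eq_add_neg, div_eq_mul_inv]
  rw [this, measure_preimage_add_right, Real.volume_preimage_mul_right (inv_ne_zero hp.ne'),
    inv_inv, abs_of_pos hp]

theorem circlePoint_add_two_pi (θ : ℝ) : circlePoint (θ + 2 * Real.pi) = circlePoint θ := by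
  simp [circlePoint]

/-- Rotation invariance in the form needed later: the starting angle is free, and `t` counts
half-turns, so the whole circle has length `2`. -/
theorem circleUniform_apply_of_start {A : Set (Metric.sphere (0 : EuclideanSpace ℝ (Fin 2)) 1)}
    (hA : MeasurableSet A) (a : ℝ) : circleUniform A =
      2⁻¹ * volume {t | t ∈ Set.Ioo (0 : ℝ) 2 ∧ circlePoint (a + Real.pi * t) ∈ A} := by
  have hpi := Real.pi_pos
  have h := volume_inter_Ioo_of_periodic (measurable_circlePoint hA) Real.two_pi_pos
    (fun x => by rw [Set.mem_preimage, Set.mem_preimage, circlePoint_add_two_pi]) (-Real.pi) a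
  rw [show -Real.pi + 2 * Real.pi = Real.pi by ring] at h
  rw [circleUniform_apply hA, h]
  have h2 : circlePoint ⁻¹' A ∩ Set.Ioo a (a + 2 * Real.pi) = (fun t => (t - a) / Real.pi) ⁻¹'
      {t | t ∈ Set.Ioo (0 : ℝ) 2 ∧ circlePoint (a + Real.pi * t) ∈ A} := by
    ext θ
    simp only [Set.mem_inter_iff, Set.mem_preimage, Set.mem_ofPred_eq, Set.mem_Ioo]
    rw [mul_div_cancel₀ _ hpi.ne', add_sub_cancel, lt_div_iff₀ hpi, div_lt_iff₀ hpi, zero_mul,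
      sub_pos, sub_lt_iff_lt_add']
    tauto
  rw [h2, volume_preimage_sub_div hpi, ← mul_assoc, ENNReal.ofReal_mul zero_le_two,
    ENNReal.mul_inv (by simp) (by simp), mul_assoc _ _ (ENNReal.ofReal Real.pi),
    ENNReal.inv_mul_cancel (by simpa using hpi) ENNReal.ofReal_ne_top]
  simp

/-- A line only sees the angle modulo `π`. The interval `(-π, π)` consists of two periods, and each
may be shifted to start at `a`; the law therefore does not depend on `a`. -/
theorem map_fract_uniformAngle (a : ℝ) :
    uniformAngle.map (fun θ => Int.fract ((θ - a) / Real.pi)) =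
      volume.restrict (Set.Ioo (0 : ℝ) 1) := by
  have hpi := Real.pi_pos
  have hm : Measurable fun θ => Int.fract ((θ - a) / Real.pi) := by fun_prop
  ext B hB
  rw [Measure.map_apply hm hB, uniformAngle, Measure.smul_apply, smul_eq_mul,
    Measure.restrict_apply (hm hB), Measure.restrict_apply hB]
  set S := (fun θ => Int.fract ((θ - a) / Real.pi)) ⁻¹' B with hS
  have hper : ∀ x, x + Real.pi ∈ S ↔ x ∈ S := by
    intro x
    rw [hS, Set.mem_preimage, Set.mem_preimage, add_sub_right_comm, add_div, div_self hpi.ne',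
      Int.fract_add_one]
  have h1 := volume_inter_Ioo_of_periodic (hm hB) hpi hper (-Real.pi) a
  have h2 := volume_inter_Ioo_of_periodic (hm hB) hpi hper 0 a
  rw [neg_add_cancel] at h1
  rw [zero_add] at h2
  have h3 : volume (S ∩ Set.Ioo (-Real.pi) Real.pi) = 2 * volume (S ∩ Set.Ioo a (a + Real.pi)) := by
    have e : volume (S ∩ Set.Ioo (-Real.pi) Real.pi) =
        volume ((S ∩ Set.Ioo (-Real.pi) 0) ∪ (S ∩ Set.Ioo 0 Real.pi)) := by
      refine measure_congr ?_
      filter_upwards [Measure.ae_ne (volume : Measure ℝ) 0] with x hx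
      apply propext
      change (x ∈ S ∧ -Real.pi < x ∧ x < Real.pi) ↔
        (x ∈ S ∧ -Real.pi < x ∧ x < 0) ∨ (x ∈ S ∧ 0 < x ∧ x < Real.pi)
      constructor
      · rintro ⟨h, h1, h2⟩
        rcases lt_or_gt_of_ne hx with h' | h'
        · exact Or.inl ⟨h, h1, h'⟩
        · exact Or.inr ⟨h, h', h2⟩
      · rintro (⟨h, h1, h2⟩ | ⟨h, h1, h2⟩)
        · exact ⟨h, h1, by linarith⟩
        · exact ⟨h, by linarith, h2⟩
    rw [e, measure_union _ ((hm hB).inter measurableSet_Ioo)]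
    · rw [h1, h2, two_mul]
    · refine Set.disjoint_left.2 fun x hx hx' => ?_
      exact lt_asymm hx.2.2 hx'.2.1
  have h4 : S ∩ Set.Ioo a (a + Real.pi) = (fun t => (t - a) / Real.pi) ⁻¹' (B ∩ Set.Ioo 0 1) := by
    ext x
    simp only [Set.mem_inter_iff, Set.mem_preimage, Set.mem_Ioo, hS]
    rw [lt_div_iff₀ hpi, div_lt_iff₀ hpi, zero_mul, one_mul, sub_pos, sub_lt_iff_lt_add']
    refine and_congr_left fun ⟨h, h'⟩ => ?_
    rw [Int.fract_eq_self.2]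
    exact ⟨div_nonneg (by linarith) hpi.le, (div_lt_one hpi).2 (by linarith)⟩
  rw [h3, h4, volume_preimage_sub_div hpi, ← mul_assoc 2, ← mul_assoc,
    ENNReal.ofReal_mul zero_le_two]
  rw [ENNReal.ofReal_ofNat, ENNReal.inv_mul_cancel (by simpa using hpi), one_mul]
  exact ENNReal.mul_ne_top (by simp) ENNReal.ofReal_ne_top

/-- The angles of the lines `a j`, `j ≠ k`, measured from the line `a k`, as fractions of a
half-turn. -/
noncomputable def relAngles {m : ℕ} (k : Fin (m + 1)) (a : Fin (m + 1) → ℝ) : Fin m → ℝ :=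
  fun j => Int.fract ((a (k.succAbove j) - a k) / Real.pi)

theorem measurable_relAngles {m : ℕ} (k : Fin (m + 1)) : Measurable (relAngles k) := by
  unfold relAngles
  fun_prop

/-- Fubini over the reference angle `a k`: for each fixed value the other coordinates are
independent and, by `map_fract_uniformAngle`, uniform. -/
theorem map_relAngles {m : ℕ} (k : Fin (m + 1)) :
    (Measure.pi fun _ => uniformAngle).map (relAngles k) = uniformPoints m := by
  have hmp := measurePreserving_piFinSuccAbove (fun _ : Fin (m + 1) => uniformAngle) k
  have hg : Measurable fun p : ℝ × (Fin m → ℝ) => fun j => Int.fract ((p.2 j - p.1) / Real.pi) := by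
    fun_prop
  have hcomp : relAngles k = (fun p : ℝ × (Fin m → ℝ) => fun j => Int.fract ((p.2 j - p.1) / Real.pi))
      ∘ MeasurableEquiv.piFinSuccAbove (fun _ => ℝ) k := rfl
  rw [hcomp, ← Measure.map_map hg hmp.measurable, hmp.map_eq]
  ext B hB
  rw [Measure.map_apply hg hB, Measure.prod_apply (hg hB)]
  have h : ∀ x : ℝ, (Measure.pi fun _ : Fin m => uniformAngle) (Prod.mk x ⁻¹'
      ((fun p : ℝ × (Fin m → ℝ) => fun j => Int.fract ((p.2 j - p.1) / Real.pi)) ⁻¹' B)) =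
        uniformPoints m B := by
    intro x
    have hx : ∀ _ : Fin m, AEMeasurable (fun θ => Int.fract ((θ - x) / Real.pi)) uniformAngle :=
      fun _ => by fun_prop
    have hs : ∀ _ : Fin m, SigmaFinite (uniformAngle.map fun θ => Int.fract ((θ - x) / Real.pi)) :=
      fun _ => by rw [map_fract_uniformAngle]; infer_instance
    have := Measure.pi_map_pi (μ := fun _ : Fin m => uniformAngle) hx
    simp only [map_fract_uniformAngle] at this
    rw [uniformPoints, ← this, Measure.map_apply (by fun_prop) hB]
    rfl
  simp only [h, lintegral_const, measure_univ, mul_one]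

/-- The argument of the `i`-th row. -/
noncomputable def rowAngle {n : ℕ} (X : Matrix (Fin n) (Fin 2) ℝ) (i : Fin n) : ℝ :=
  planeAngle (X i 0, X i 1)

theorem IsGaussianMatrix.hasLaw_rowAngle {Ω : Type*} [MeasurableSpace Ω] {P : Measure Ω}
    [IsProbabilityMeasure P] {n : ℕ} {X : Ω → Matrix (Fin n) (Fin 2) ℝ}
    (hX : IsGaussianMatrix X P) :
    HasLaw (fun ω => rowAngle (X ω)) (Measure.pi fun _ => uniformAngle) P := by
  have h1 : HasLaw (fun ω (p : Fin n × Fin 2) => X ω p.1 p.2)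
      (Measure.pi fun _ => gaussianReal 0 1) P := hX.1.hasLaw_pi fun p => hX.2 p.1 p.2
  have hc : MeasurePreserving (MeasurableEquiv.curry (Fin n) (Fin 2) ℝ)
      (Measure.pi fun _ => gaussianReal 0 1)
      (Measure.pi fun _ => Measure.pi fun _ => gaussianReal 0 1) := by
    refine ⟨MeasurableEquiv.measurable _, ?_⟩
    have := Measure.infinitePi_map_curry (fun (_ : Fin n) (_ : Fin 2) => gaussianReal 0 1)
    simpa only [Measure.infinitePi_eq_pi] using this
  have ha : MeasurePreserving (fun v : Fin 2 → ℝ => planeAngle (v 0, v 1))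
      (Measure.pi fun _ => gaussianReal 0 1) uniformAngle :=
    (MeasurePreserving.mk measurable_planeAngle map_planeAngle_gaussian).comp
      (measurePreserving_finTwoArrow (gaussianReal 0 1))
  have hp := measurePreserving_pi (fun _ : Fin n => Measure.pi fun _ : Fin 2 => gaussianReal 0 1)
    (fun _ => uniformAngle) fun _ => ha
  exact (hp.comp hc).comp_hasLaw h1

theorem IsGaussianMatrix.hasLaw_relAngles {Ω : Type*} [MeasurableSpace Ω] {P : Measure Ω}
    [IsProbabilityMeasure P] {m : ℕ} {X : Ω → Matrix (Fin (m + 1)) (Fin 2) ℝ}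
    (hX : IsGaussianMatrix X P) (k : Fin (m + 1)) :
    HasLaw (fun ω => relAngles k (rowAngle (X ω))) (uniformPoints m) P :=
  (MeasurePreserving.mk (measurable_relAngles k) (map_relAngles k)).comp_hasLaw hX.hasLaw_rowAngle

/-- A nonzero first entry already makes the row nonzero, and it only needs that a one-dimensional
Gaussian has no atoms. -/
theorem IsGaussianMatrix.ae_ne_zero {Ω : Type*} [MeasurableSpace Ω] {P : Measure Ω}
    {n : ℕ} {X : Ω → Matrix (Fin n) (Fin 2) ℝ}
    (hX : IsGaussianMatrix X P) : ∀ᵐ ω ∂P, ∀ i, X ω i 0 ≠ 0 := by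
  rw [ae_all_iff]
  intro i
  have := (hX.2 i 0).ae_iff (p := fun x => x ≠ 0) (by measurability)
  rw [this]
  have := nullSingletonClass_gaussianReal (μ := 0) one_ne_zero
  exact Measure.ae_ne _ 0

/-! ### Sign patterns along a segment cut by points -/

theorem orderSimplex_lo_lt_hi {m : ℕ} {w : Fin m → ℝ} (hw : w ∈ orderSimplex m) (j : Fin (m + 1)) :
    (Fin.cons 0 w : Fin (m + 1) → ℝ) j < (Fin.snoc w 1 : Fin (m + 1) → ℝ) j :=
  sub_pos.1 ((gaps_one_pos_iff w).2 hw j)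

theorem orderSimplex_strictMono_lo {m : ℕ} {w : Fin m → ℝ} (hw : w ∈ orderSimplex m) :
    StrictMono (Fin.cons 0 w : Fin (m + 1) → ℝ) := by
  rw [Fin.strictMono_iff_lt_succ]
  intro i
  have := orderSimplex_lo_lt_hi hw i.castSucc
  rwa [Fin.snoc_castSucc] at this

theorem orderSimplex_hi_le_lo {m : ℕ} {w : Fin m → ℝ} (hw : w ∈ orderSimplex m)
    {i j : Fin (m + 1)} (hij : i < j) :
    (Fin.snoc w 1 : Fin (m + 1) → ℝ) i ≤ (Fin.cons 0 w : Fin (m + 1) → ℝ) j := by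
  obtain ⟨i', rfl⟩ := Fin.exists_castSucc_eq.2 (ne_of_lt (lt_of_lt_of_le hij (Fin.le_last j)))
  rw [Fin.snoc_castSucc]
  have := (orderSimplex_strictMono_lo hw).monotone (show i'.succ ≤ j from hij)
  rwa [Fin.cons_succ] at this

theorem orderSimplex_lo_nonneg {m : ℕ} {w : Fin m → ℝ} (hw : w ∈ orderSimplex m)
    (j : Fin (m + 1)) : 0 ≤ (Fin.cons 0 w : Fin (m + 1) → ℝ) j :=
  (orderSimplex_strictMono_lo hw).monotone (Fin.zero_le j)

theorem orderSimplex_hi_le_one {m : ℕ} {w : Fin m → ℝ} (hw : w ∈ orderSimplex m)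
    (j : Fin (m + 1)) : (Fin.snoc w 1 : Fin (m + 1) → ℝ) j ≤ 1 := by
  refine Fin.lastCases ?_ (fun i => ?_) j
  · simp
  · rw [Fin.snoc_castSucc]
    exact (hw.2 i).2.le

/-- If no interval caught `t`, induction would push `t` past every right endpoint. The intervals
being half-open, `t = 1` is assigned to the last one. -/
theorem orderSimplex_cover {m : ℕ} (w : Fin m → ℝ) {t : ℝ} (h0 : 0 ≤ t) (h1 : t ≤ 1) :
    ∃ j, (Fin.cons 0 w : Fin (m + 1) → ℝ) j ≤ t ∧
      (t < (Fin.snoc w 1 : Fin (m + 1) → ℝ) j ∨ t = 1 ∧ j = Fin.last m) := by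
  by_contra! h
  have hle : ∀ j, (Fin.cons 0 w : Fin (m + 1) → ℝ) j ≤ t := by
    intro j
    induction j using Fin.induction with
    | zero => simpa using h0
    | succ i ih =>
      have := (h _ ih).1
      rwa [Fin.snoc_castSucc] at this
  have h2 := h _ (hle (Fin.last m))
  rw [Fin.snoc_last] at h2
  exact h2.2 (le_antisymm h1 h2.1) rfl

/-- The midpoints of the consecutive intervals cut out of `[0, 1]` by `w`. -/
noncomputable def gapMid {m : ℕ} (w : Fin m → ℝ) (j : Fin (m + 1)) : ℝ :=
  ((Fin.cons 0 w : Fin (m + 1) → ℝ) j + (Fin.snoc w 1 : Fin (m + 1) → ℝ) j) / 2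

theorem lo_lt_gapMid {m : ℕ} {w : Fin m → ℝ} (hw : w ∈ orderSimplex m) (j : Fin (m + 1)) :
    (Fin.cons 0 w : Fin (m + 1) → ℝ) j < gapMid w j := by
  have := orderSimplex_lo_lt_hi hw j
  unfold gapMid
  linarith

theorem gapMid_lt_hi {m : ℕ} {w : Fin m → ℝ} (hw : w ∈ orderSimplex m) (j : Fin (m + 1)) :
    gapMid w j < (Fin.snoc w 1 : Fin (m + 1) → ℝ) j := by
  have := orderSimplex_lo_lt_hi hw j
  unfold gapMid
  linarith

theorem gapMid_mem {m : ℕ} {w : Fin m → ℝ} (hw : w ∈ orderSimplex m) (j : Fin (m + 1)) :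
    gapMid w j ∈ Set.Ioo (0 : ℝ) 1 :=
  ⟨(orderSimplex_lo_nonneg hw j).trans_lt (lo_lt_gapMid hw j),
    (gapMid_lt_hi hw j).trans_le (orderSimplex_hi_le_one hw j)⟩

/-- The sign pattern at `t` of lines located at `V i` with orientations `ε i`. -/
noncomputable def linePattern {n : ℕ} (ε : Fin n → Bool) (V : Fin n → ℝ) (t : ℝ) : Fin n → Bool :=
  fun i => if ε i then decide (V i ≤ t) else decide (t ≤ V i)

/-- Only a weak inequality can hold: on the line itself the entry is `true` for either orientation.
-/
theorem le_of_linePattern_eq {n : ℕ} {ε : Fin n → Bool} {V : Fin n → ℝ} {s t : ℝ} {i : Fin n}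
    (h : linePattern ε V t = linePattern ε V s) (hs : s < V i) : t ≤ V i := by
  have := congrFun h i
  unfold linePattern at this
  split_ifs at this
  · rw [decide_eq_decide] at this
    exact (not_le.1 fun h => hs.not_ge (this.1 h)).le
  · rw [decide_eq_decide] at this
    exact this.2 hs.le

theorem ge_of_linePattern_eq {n : ℕ} {ε : Fin n → Bool} {V : Fin n → ℝ} {s t : ℝ} {i : Fin n}
    (h : linePattern ε V t = linePattern ε V s) (hs : V i < s) : V i ≤ t := by
  have := congrFun h i
  unfold linePattern at this
  split_ifs at this
  · rw [decide_eq_decide] at this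
    exact this.2 hs.le
  · rw [decide_eq_decide] at this
    exact (not_le.1 fun h => hs.not_ge (this.1 h)).le

theorem linePattern_ne {n : ℕ} {ε : Fin n → Bool} {V : Fin n → ℝ} {s t : ℝ} {i : Fin n}
    (hs : s < V i) (ht : V i < t) : linePattern ε V s ≠ linePattern ε V t := by
  intro h
  have := congrFun h i
  unfold linePattern at this
  split_ifs at this
  · rw [decide_eq_decide] at this
    exact hs.not_ge (this.2 ht.le)
  · rw [decide_eq_decide] at this
    exact ht.not_ge (this.1 hs.le)

theorem linePattern_of_lt {n : ℕ} {ε : Fin n → Bool} {V : Fin n → ℝ} {t : ℝ} {i : Fin n}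
    (h : V i < t) : linePattern ε V t i = ε i := by
  unfold linePattern
  cases hε : ε i <;> simp [h, h.le]

theorem linePattern_of_gt {n : ℕ} {ε : Fin n → Bool} {V : Fin n → ℝ} {t : ℝ} {i : Fin n}
    (h : t < V i) : linePattern ε V t i = !ε i := by
  unfold linePattern
  cases hε : ε i <;> simp [h, h.le]

theorem linePattern_of_eq {n : ℕ} {ε : Fin n → Bool} {V : Fin n → ℝ} {t : ℝ} {i : Fin n}
    (h : V i = t) : linePattern ε V t i = true := by
  unfold linePattern
  cases hε : ε i <;> simp [h]

theorem linePattern_not {n : ℕ} (ε : Fin n → Bool) {V : Fin n → ℝ} {t : ℝ} (ht : ∀ i, V i ≠ t) :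
    linePattern (fun i => !ε i) V t = complPattern (linePattern ε V t) := by
  ext1 i
  rw [complPattern]
  rcases lt_or_gt_of_ne (ht i) with h | h
  · rw [linePattern_of_lt h, linePattern_of_lt h]
  · rw [linePattern_of_gt h, linePattern_of_gt h]

/-- The lines `V` are located at `0` and at the points of `w`. -/
structure LinesAt {m : ℕ} (V : Fin (m + 1) → ℝ) (w : Fin m → ℝ) : Prop where
  mem : w ∈ orderSimplex m
  inj : Function.Injective V
  left : ∀ i, ∃ j, V i = (Fin.cons 0 w : Fin (m + 1) → ℝ) j
  right : ∀ j, ∃ i, V i = (Fin.cons 0 w : Fin (m + 1) → ℝ) j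

namespace LinesAt

variable {m : ℕ} {V : Fin (m + 1) → ℝ} {w : Fin m → ℝ}

theorem le_lo_or (h : LinesAt V w) (i j : Fin (m + 1)) :
    V i ≤ (Fin.cons 0 w : Fin (m + 1) → ℝ) j ∨ (Fin.snoc w 1 : Fin (m + 1) → ℝ) j ≤ V i := by
  obtain ⟨j', hj'⟩ := h.left i
  rw [hj']
  rcases le_or_gt j' j with hle | hlt
  · exact Or.inl ((orderSimplex_strictMono_lo h.mem).monotone hle)
  · exact Or.inr (orderSimplex_hi_le_lo h.mem hlt)

theorem linePattern_of_mem (h : LinesAt V w) (ε : Fin (m + 1) → Bool) {t : ℝ} {j : Fin (m + 1)}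
    (ht : t ∈ Set.Ioo ((Fin.cons 0 w : Fin (m + 1) → ℝ) j) ((Fin.snoc w 1 : Fin (m + 1) → ℝ) j)) :
    linePattern ε V t = linePattern ε V (gapMid w j) := by
  ext1 i
  rcases h.le_lo_or i j with hi | hi
  · rw [linePattern_of_lt (hi.trans_lt ht.1),
      linePattern_of_lt (hi.trans_lt (lo_lt_gapMid h.mem j))]
  · rw [linePattern_of_gt (ht.2.trans_le hi),
      linePattern_of_gt ((gapMid_lt_hi h.mem j).trans_le hi)]

theorem ne_gapMid (h : LinesAt V w) (i j : Fin (m + 1)) : V i ≠ gapMid w j := by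
  rcases h.le_lo_or i j with hi | hi
  · exact (hi.trans_lt (lo_lt_gapMid h.mem j)).ne
  · exact ((gapMid_lt_hi h.mem j).trans_le hi).ne'

theorem mem_Icc (h : LinesAt V w) {ε : Fin (m + 1) → Bool} {t : ℝ} (ht : t ≤ 1) {j : Fin (m + 1)}
    (hp : linePattern ε V t = linePattern ε V (gapMid w j)) :
    t ∈ Set.Icc ((Fin.cons 0 w : Fin (m + 1) → ℝ) j) ((Fin.snoc w 1 : Fin (m + 1) → ℝ) j) := by
  constructor
  · obtain ⟨i, hi⟩ := h.right j
    rw [← hi]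
    exact ge_of_linePattern_eq hp (hi ▸ lo_lt_gapMid h.mem j)
  · have hlt := gapMid_lt_hi h.mem j
    revert hp hlt
    refine Fin.lastCases ?_ (fun j' => ?_) j
    · intro _ _
      simpa using ht
    · intro hp hlt
      obtain ⟨i, hi⟩ := h.right j'.succ
      rw [Fin.cons_succ] at hi
      rw [Fin.snoc_castSucc] at hlt ⊢
      rw [← hi]
      exact le_of_linePattern_eq hp (hi ▸ hlt)

/-- Two different intervals are separated by the line at the left end of the later one. -/
theorem linePattern_injective (h : LinesAt V w) (ε : Fin (m + 1) → Bool) :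
    Function.Injective fun j => linePattern ε V (gapMid w j) := by
  have key : ∀ i j, i < j → linePattern ε V (gapMid w i) ≠ linePattern ε V (gapMid w j) := by
    intro i j hij
    obtain ⟨l, hl⟩ := h.right j
    refine linePattern_ne (i := l) ?_ (hl ▸ lo_lt_gapMid h.mem j)
    rw [hl]
    exact (gapMid_lt_hi h.mem i).trans_le (orderSimplex_hi_le_lo h.mem hij)
  intro i j hij
  by_contra hne
  rcases lt_or_gt_of_ne hne with hlt | hlt
  · exact key i j hlt hij
  · exact key j i hlt hij.symm

/-- Points on a line create no new pattern. By injectivity of `V` only one line passes there, and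
its entry is `true`, so the pattern is that of the adjacent interval on the positive side of this
line. -/
theorem exists_linePattern_eq (h : LinesAt V w) {ε : Fin (m + 1) → Bool} {k : Fin (m + 1)}
    (hk : V k = 0) {t : ℝ} (h0 : 0 ≤ t) (h1 : t ≤ 1) (hε : 0 < t ∨ ε k = true) :
    ∃ j, linePattern ε V t = linePattern ε V (gapMid w j) := by
  obtain ⟨j, hj, hj'⟩ := orderSimplex_cover w h0 h1
  rcases hj' with hj' | ⟨rfl, rfl⟩
  · rcases hj.lt_or_eq with hlt | heq
    · exact ⟨j, h.linePattern_of_mem ε ⟨hlt, hj'⟩⟩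
    · obtain ⟨i₀, hi₀⟩ := h.right j
      have hne : ∀ i, i ≠ i₀ → V i ≠ t := fun i hi hc => hi (h.inj (by rw [hi₀, heq, hc]))
      by_cases hε₀ : ε i₀ = true
      · refine ⟨j, ?_⟩
        ext1 i
        rcases h.le_lo_or i j with hi | hi
        · rw [linePattern_of_lt (hi.trans_lt (lo_lt_gapMid h.mem j))]
          by_cases hii : i = i₀
          · rw [linePattern_of_eq (by rw [hii, hi₀, heq]), hii, hε₀]
          · rw [linePattern_of_lt (lt_of_le_of_ne (heq ▸ hi) (hne i hii))]
        · rw [linePattern_of_gt ((gapMid_lt_hi h.mem j).trans_le hi),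
            linePattern_of_gt (hj'.trans_le hi)]
      -- The positive side is now the left one. At `t = 0` there is no interval to the left, but the
      -- line is then that of `k`, and `hε` excludes this case.
      · rcases Fin.eq_zero_or_eq_succ j with rfl | ⟨j', rfl⟩
        · rw [Fin.cons_zero] at hi₀ heq
          have : i₀ = k := h.inj (by rw [hi₀, hk])
          subst this
          rcases hε with hε | hε
          · exact absurd heq hε.ne
          · exact absurd hε hε₀
        · refine ⟨j'.castSucc, ?_⟩
          have hw : (Fin.snoc w 1 : Fin (m + 1) → ℝ) j'.castSucc = t := by
            rw [← heq]; simp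
          ext1 i
          rcases h.le_lo_or i j'.castSucc with hi | hi
          · have hlt := hi.trans_lt (lo_lt_gapMid h.mem _)
            rw [linePattern_of_lt hlt,
              linePattern_of_lt (hlt.trans ((gapMid_lt_hi h.mem _).trans_eq hw))]
          · rw [linePattern_of_gt ((gapMid_lt_hi h.mem _).trans_le hi)]
            by_cases hii : i = i₀
            · rw [linePattern_of_eq (by rw [hii, hi₀, heq]), hii]
              simpa using hε₀
            · rw [linePattern_of_gt (lt_of_le_of_ne (hw ▸ hi) (hne i hii).symm)]
  · refine ⟨Fin.last m, ?_⟩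
    ext1 i
    have hi : V i ≤ (Fin.cons 0 w : Fin (m + 1) → ℝ) (Fin.last m) := by
      obtain ⟨l, hl⟩ := h.left i
      rw [hl]
      exact (orderSimplex_strictMono_lo h.mem).monotone (Fin.le_last l)
    have hlt := hi.trans_lt (lo_lt_gapMid h.mem _)
    rw [linePattern_of_lt hlt, linePattern_of_lt (hlt.trans (gapMid_mem h.mem _).2)]

end LinesAt

/-! ### From the matrix to lines on the half-circle -/

/-- The position of the line orthogonal to the `i`-th row, relative to that of the `k`-th row, as a
fraction of a half-turn. -/
noncomputable def lineAngle {n : ℕ} (X : Matrix (Fin n) (Fin 2) ℝ) (k i : Fin n) : ℝ :=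
  Int.fract ((rowAngle X i - rowAngle X k) / Real.pi)

/-- The side on which the `i`-th row lies, seen from the `k`-th row. -/
noncomputable def lineSide {n : ℕ} (X : Matrix (Fin n) (Fin 2) ℝ) (k i : Fin n) : Bool :=
  decide (Even ⌊(rowAngle X i - rowAngle X k) / Real.pi⌋)

/-- The point of the circle reached after `t` half-turns, starting from the beginning of the
half-circle of the `k`-th row. -/
noncomputable def arcPoint {n : ℕ} (X : Matrix (Fin n) (Fin 2) ℝ) (k : Fin n) (t : ℝ) :
    Metric.sphere (0 : EuclideanSpace ℝ (Fin 2)) 1 :=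
  circlePoint (rowAngle X k - Real.pi / 2 + Real.pi * t)

theorem mulVec_apply_fin_two {n : ℕ} (X : Matrix (Fin n) (Fin 2) ℝ) (u : EuclideanSpace ℝ (Fin 2))
    (i : Fin n) : X.mulVec u.ofLp i = X i 0 * u 0 + X i 1 * u 1 := by
  simp [Matrix.mulVec, dotProduct, Fin.sum_univ_two]

theorem measurableSet_chamber {n : ℕ} (X : Matrix (Fin n) (Fin 2) ℝ) (D : Fin n → Bool) :
    MeasurableSet (chamber X D) := by
  have h : chamber X D = ⋂ i, {u : Metric.sphere (0 : EuclideanSpace ℝ (Fin 2)) 1 |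
      (0 ≤ X i 0 * (u : EuclideanSpace ℝ (Fin 2)) 0 + X i 1 * (u : EuclideanSpace ℝ (Fin 2)) 1) ↔
        D i = true} := by
    ext u
    simp only [chamber, Set.mem_ofPred_eq, Set.mem_iInter, funext_iff, activationPattern,
      mulVec_apply_fin_two]
    refine forall_congr' fun i => ?_
    rw [Bool.eq_iff_iff, decide_eq_true_iff]
  rw [h]
  refine MeasurableSet.iInter fun i => ?_
  have hm : MeasurableSet {u : Metric.sphere (0 : EuclideanSpace ℝ (Fin 2)) 1 |
      0 ≤ X i 0 * (u : EuclideanSpace ℝ (Fin 2)) 0 + X i 1 * (u : EuclideanSpace ℝ (Fin 2)) 1} := by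
    refine (isClosed_le continuous_const ?_).measurableSet
    fun_prop
  by_cases hD : D i = true
  · simpa [hD] using hm
  · convert hm.compl using 1
    ext u
    simp [hD]

theorem exists_circlePoint (u : Metric.sphere (0 : EuclideanSpace ℝ (Fin 2)) 1) :
    ∃ θ, circlePoint θ = u := by
  set z : ℂ := ⟨(u : EuclideanSpace ℝ (Fin 2)) 0, (u : EuclideanSpace ℝ (Fin 2)) 1⟩
  have h := norm_eq_of_mem_sphere u
  rw [EuclideanSpace.norm_eq, Fin.sum_univ_two] at h
  have hn : ‖z‖ = 1 := by
    rw [Complex.norm_eq_sqrt_sq_add_sq]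
    simpa using h
  refine ⟨z.arg, ?_⟩
  apply Subtype.ext
  ext i
  fin_cases i
  · change Real.cos z.arg = z.re
    rw [← Complex.norm_mul_cos_arg z, hn, one_mul]
  · change Real.sin z.arg = z.im
    rw [← Complex.norm_mul_sin_arg z, hn, one_mul]

theorem exists_arcPoint {n : ℕ} (X : Matrix (Fin n) (Fin 2) ℝ) (k : Fin n)
    (u : Metric.sphere (0 : EuclideanSpace ℝ (Fin 2)) 1) :
    ∃ t, 0 ≤ t ∧ t < 2 ∧ arcPoint X k t = u := by
  obtain ⟨θ, rfl⟩ := exists_circlePoint u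
  set y := (θ - (rowAngle X k - Real.pi / 2)) / (2 * Real.pi) with hy
  have hpi := Real.pi_pos
  refine ⟨2 * Int.fract y, by linarith [Int.fract_nonneg y], by linarith [Int.fract_lt_one y], ?_⟩
  have hp : Function.Periodic circlePoint (2 * Real.pi) := circlePoint_add_two_pi
  have : rowAngle X k - Real.pi / 2 + Real.pi * (2 * Int.fract y) = θ - ⌊y⌋ * (2 * Real.pi) := by
    have h1 : Int.fract y = y - ⌊y⌋ := rfl
    have h2 : y * (2 * Real.pi) = θ - (rowAngle X k - Real.pi / 2) :=
      div_mul_cancel₀ _ (by positivity)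
    rw [h1]
    linear_combination h2
  rw [arcPoint, this, hp.sub_int_mul_eq]

/-- The inner product is the norm of the row times the cosine of an angle difference, a sine after
the shift by `π / 2`. Reducing the position of the line modulo a half-turn costs the sign `(-1) ^
⌊y⌋`, which `lineSide` records. -/
theorem mulVec_arcPoint {n : ℕ} (X : Matrix (Fin n) (Fin 2) ℝ) (k i : Fin n) (t : ℝ) :
    X.mulVec (arcPoint X k t : EuclideanSpace ℝ (Fin 2)).ofLp i =
      ‖(⟨X i 0, X i 1⟩ : ℂ)‖ * ((if lineSide X k i then 1 else -1) *
        Real.sin (Real.pi * (t - lineAngle X k i))) := by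
  have hpi := Real.pi_pos
  set z : ℂ := ⟨X i 0, X i 1⟩
  have h0 : X i 0 = ‖z‖ * Real.cos (rowAngle X i) := (Complex.norm_mul_cos_arg z).symm
  have h1 : X i 1 = ‖z‖ * Real.sin (rowAngle X i) := (Complex.norm_mul_sin_arg z).symm
  set y := (rowAngle X i - rowAngle X k) / Real.pi with hy
  have hs : (if lineSide X k i then (1 : ℝ) else -1) = (-1) ^ ⌊y⌋ := by
    unfold lineSide
    rw [← hy]
    by_cases he : Even ⌊y⌋
    · simp [he, he.neg_one_zpow]
    · simp [he, (Int.not_even_iff_odd.1 he).neg_one_zpow]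
  rw [mulVec_apply_fin_two, h0, h1, arcPoint, circlePoint_zero, circlePoint_one, hs,
    ← Real.sin_sub_int_mul_pi]
  have hy' : y * Real.pi = rowAngle X i - rowAngle X k := div_mul_cancel₀ _ hpi.ne'
  have hV : lineAngle X k i = y - ⌊y⌋ := rfl
  have harg : Real.pi * (t - lineAngle X k i) - ⌊y⌋ * Real.pi =
      (rowAngle X k - Real.pi / 2 + Real.pi * t) - rowAngle X i + Real.pi / 2 := by
    rw [hV]
    linear_combination -hy'
  rw [harg, Real.sin_add_pi_div_two, Real.cos_sub]
  ring

theorem sin_pi_mul_nonneg_iff {x : ℝ} (h1 : -1 < x) (h2 : x < 1) :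
    0 ≤ Real.sin (Real.pi * x) ↔ 0 ≤ x := by
  have hpi := Real.pi_pos
  constructor
  · intro h
    by_contra! hx
    exact (Real.sin_neg_of_neg_of_neg_pi_lt (by nlinarith) (by nlinarith)).not_ge h
  · intro h
    exact Real.sin_nonneg_of_nonneg_of_le_pi (by positivity) (by nlinarith)

theorem sin_pi_mul_nonpos_iff {x : ℝ} (h1 : -1 < x) (h2 : x < 1) :
    Real.sin (Real.pi * x) ≤ 0 ↔ x ≤ 0 := by
  have := sin_pi_mul_nonneg_iff (x := -x) (by linarith) (by linarith)
  rwa [mul_neg, Real.sin_neg, neg_nonneg, neg_nonneg] at this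

theorem lineAngle_self {n : ℕ} (X : Matrix (Fin n) (Fin 2) ℝ) (k : Fin n) :
    lineAngle X k k = 0 := by
  simp [lineAngle]

theorem lineSide_self {n : ℕ} (X : Matrix (Fin n) (Fin 2) ℝ) (k : Fin n) :
    lineSide X k k = true := by
  simp [lineSide]

/-! ### Chambers of a generic matrix -/

/-- No row vanishes and no two rows are parallel. -/
structure GenericRows {m : ℕ} (X : Matrix (Fin (m + 1)) (Fin 2) ℝ) (k : Fin (m + 1)) : Prop where
  ne_zero : ∀ i, X i 0 ≠ 0
  inj : Function.Injective (relAngles k (rowAngle X))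
  mem : ∀ j, relAngles k (rowAngle X) j ∈ Set.Ioo (0 : ℝ) 1

theorem IsGaussianMatrix.ae_genericRows {Ω : Type*} [MeasurableSpace Ω] {P : Measure Ω}
    [IsProbabilityMeasure P] {m : ℕ} {X : Ω → Matrix (Fin (m + 1)) (Fin 2) ℝ}
    (hX : IsGaussianMatrix X P) (k : Fin (m + 1)) : ∀ᵐ ω ∂P, GenericRows (X ω) k := by
  have h := hX.hasLaw_relAngles k
  have h2 := uniformPoints_ae m
  rw [← h.map_eq] at h2
  have h3 := ae_of_ae_map h.aemeasurable h2
  filter_upwards [hX.ae_ne_zero, h3] with ω h4 h5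
  exact ⟨h4, h5.1, h5.2⟩

/-- The positions of the lines other than the `k`-th one, in increasing order. -/
noncomputable def cuts {m : ℕ} (X : Matrix (Fin (m + 1)) (Fin 2) ℝ) (k : Fin (m + 1)) :
    Fin m → ℝ := sorted (relAngles k (rowAngle X))

/-- The patterns of the half-circle of the `k`-th row in counterclockwise order. -/
noncomputable def arcPattern {m : ℕ} (X : Matrix (Fin (m + 1)) (Fin 2) ℝ) (k j : Fin (m + 1)) :
    Fin (m + 1) → Bool := linePattern (lineSide X k) (lineAngle X k) (gapMid (cuts X k) j)

namespace GenericRows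

variable {m : ℕ} {X : Matrix (Fin (m + 1)) (Fin 2) ℝ} {k : Fin (m + 1)}

theorem linesAt (h : GenericRows X k) : LinesAt (lineAngle X k) (cuts X k) := by
  set σ := Tuple.sort (relAngles k (rowAngle X))
  have hc : ∀ l, cuts X k l = lineAngle X k (k.succAbove (σ l)) := fun l => rfl
  refine ⟨⟨?_, fun j => h.mem (σ j)⟩, ?_, fun i => ?_, fun j => ?_⟩
  · exact (Tuple.monotone_sort _).strictMono_of_injective (h.inj.comp σ.injective)
  · intro i i' hii'
    rcases Fin.eq_self_or_eq_succAbove k i with hi | ⟨l, rfl⟩ <;>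
      rcases Fin.eq_self_or_eq_succAbove k i' with hi' | ⟨l', rfl⟩
    · rw [hi, hi']
    · rw [hi, lineAngle_self] at hii'
      exact absurd hii' (h.mem l').1.ne
    · rw [hi', lineAngle_self] at hii'
      exact absurd hii'.symm (h.mem l).1.ne
    · rw [h.inj hii']
  · rcases Fin.eq_self_or_eq_succAbove k i with hi | ⟨l, rfl⟩
    · exact ⟨0, by simp [hi, lineAngle_self]⟩
    · exact ⟨(σ.symm l).succ, by rw [Fin.cons_succ, hc, Equiv.apply_symm_apply]⟩
  · refine Fin.cases ?_ (fun l => ?_) j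
    · exact ⟨k, by simp [lineAngle_self]⟩
    · exact ⟨_, by rw [Fin.cons_succ, hc]⟩

theorem norm_pos (h : GenericRows X k) (i : Fin (m + 1)) : 0 < ‖(⟨X i 0, X i 1⟩ : ℂ)‖ := by
  rw [norm_pos_iff]
  intro hz
  exact h.ne_zero i (congrArg Complex.re hz)

theorem lineAngle_mem (i : Fin (m + 1)) : 0 ≤ lineAngle X k i ∧ lineAngle X k i < 1 :=
  ⟨Int.fract_nonneg _, Int.fract_lt_one _⟩

theorem activationPattern_eq (h : GenericRows X k) {t : ℝ} (h0 : 0 ≤ t) (h1 : t ≤ 1) :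
    activationPattern X (arcPoint X k t : EuclideanSpace ℝ (Fin 2)) =
      linePattern (lineSide X k) (lineAngle X k) t := by
  ext i
  unfold activationPattern linePattern
  rw [mulVec_arcPoint]
  simp only [mul_nonneg_iff_of_pos_left (h.norm_pos i)]
  -- Row `k` is treated apart: its line is at `0`, so `t = 1` is outside the open range of
  -- `sin_pi_mul_nonneg_iff`.
  rcases Fin.eq_self_or_eq_succAbove k i with rfl | ⟨l, rfl⟩
  · have : 0 ≤ Real.sin (Real.pi * t) :=
      Real.sin_nonneg_of_nonneg_of_le_pi (by positivity) (by nlinarith [Real.pi_pos])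
    simp [lineAngle_self, lineSide_self, h0, this]
  · have hV : lineAngle X k (k.succAbove l) ∈ Set.Ioo (0 : ℝ) 1 := h.mem l
    have e1 := sin_pi_mul_nonneg_iff (x := t - lineAngle X k (k.succAbove l))
      (by linarith [hV.2]) (by linarith [hV.1])
    have e2 := sin_pi_mul_nonpos_iff (x := t - lineAngle X k (k.succAbove l))
      (by linarith [hV.2]) (by linarith [hV.1])
    cases hs : lineSide X k (k.succAbove l)
    · simpa using e2
    · simpa using e1

theorem activationPattern_add_one_eq (h : GenericRows X k) {t : ℝ} (h0 : 0 < t) (h1 : t < 1) :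
    activationPattern X (arcPoint X k (t + 1) : EuclideanSpace ℝ (Fin 2)) =
      linePattern (fun i => !lineSide X k i) (lineAngle X k) t := by
  ext i
  unfold activationPattern linePattern
  rw [mulVec_arcPoint]
  simp only [mul_nonneg_iff_of_pos_left (h.norm_pos i)]
  have hV := lineAngle_mem (X := X) (k := k) i
  have e1 := sin_pi_mul_nonneg_iff (x := t - lineAngle X k i) (by linarith) (by linarith)
  have e2 := sin_pi_mul_nonpos_iff (x := t - lineAngle X k i) (by linarith) (by linarith)
  rw [show Real.pi * (t + 1 - lineAngle X k i) = Real.pi * (t - lineAngle X k i) + Real.pi by ring,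
    Real.sin_add_pi]
  by_cases hs : lineSide X k i = true
  · simpa [hs] using e2
  · simpa [hs] using e1

theorem arcPattern_self (h : GenericRows X k) (j : Fin (m + 1)) : arcPattern X k j k = true := by
  simp [arcPattern, linePattern, lineSide_self, lineAngle_self, (gapMid_mem h.linesAt.mem j).1.le]

theorem complPattern_arcPattern (h : GenericRows X k) (j : Fin (m + 1)) :
    complPattern (arcPattern X k j) =
      linePattern (fun i => !lineSide X k i) (lineAngle X k) (gapMid (cuts X k) j) :=
  (linePattern_not _ fun i => h.linesAt.ne_gapMid i j).symm

/-- The entry of row `k` rules out the second half-circle; on the first, the lines bounding the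
interval confine `t`. -/
theorem mem_Icc_of_mem_chamber (h : GenericRows X k) {j : Fin (m + 1)} {t : ℝ} (h0 : 0 ≤ t)
    (h2 : t < 2) (ht : arcPoint X k t ∈ chamber X (arcPattern X k j)) :
    t ∈ Set.Icc ((Fin.cons 0 (cuts X k) : Fin (m + 1) → ℝ) j)
      ((Fin.snoc (cuts X k) 1 : Fin (m + 1) → ℝ) j) := by
  change activationPattern X _ = _ at ht
  rcases le_or_gt t 1 with h1 | h1
  · rw [h.activationPattern_eq h0 h1] at ht
    exact h.linesAt.mem_Icc h1 ht
  · exfalso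
    rw [← sub_add_cancel t 1, h.activationPattern_add_one_eq (by linarith) (by linarith)] at ht
    have := congrFun ht k
    rw [h.arcPattern_self] at this
    simp [linePattern, lineSide_self, lineAngle_self] at this
    linarith

theorem mem_Icc_of_mem_chamber_compl (h : GenericRows X k) {j : Fin (m + 1)} {t : ℝ} (h0 : 0 ≤ t)
    (h2 : t < 2) (ht : arcPoint X k t ∈ chamber X (complPattern (arcPattern X k j))) :
    t ∈ Set.Icc ((Fin.cons 0 (cuts X k) : Fin (m + 1) → ℝ) j + 1)
      ((Fin.snoc (cuts X k) 1 : Fin (m + 1) → ℝ) j + 1) := by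
  change activationPattern X _ = _ at ht
  rcases le_or_gt t 1 with h1 | h1
  · exfalso
    rw [h.activationPattern_eq h0 h1] at ht
    have := congrFun ht k
    rw [complPattern, h.arcPattern_self] at this
    simp [linePattern, lineSide_self, lineAngle_self] at this
    linarith
  · rw [← sub_add_cancel t 1, h.activationPattern_add_one_eq (by linarith) (by linarith),
      h.complPattern_arcPattern] at ht
    have := h.linesAt.mem_Icc (by linarith) ht
    exact ⟨by linarith [this.1], by linarith [this.2]⟩

theorem arcPoint_mem_chamber (h : GenericRows X k) {j : Fin (m + 1)} {t : ℝ}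
    (ht : t ∈ Set.Ioo ((Fin.cons 0 (cuts X k) : Fin (m + 1) → ℝ) j)
      ((Fin.snoc (cuts X k) 1 : Fin (m + 1) → ℝ) j)) :
    arcPoint X k t ∈ chamber X (arcPattern X k j) := by
  change activationPattern X _ = _
  have h1 := orderSimplex_lo_nonneg h.linesAt.mem j
  have h2 := orderSimplex_hi_le_one h.linesAt.mem j
  rw [h.activationPattern_eq (by linarith [ht.1]) (by linarith [ht.2])]
  exact h.linesAt.linePattern_of_mem _ ht

theorem arcPoint_add_one_mem_chamber (h : GenericRows X k) {j : Fin (m + 1)} {t : ℝ}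
    (ht : t ∈ Set.Ioo ((Fin.cons 0 (cuts X k) : Fin (m + 1) → ℝ) j)
      ((Fin.snoc (cuts X k) 1 : Fin (m + 1) → ℝ) j)) :
    arcPoint X k (t + 1) ∈ chamber X (complPattern (arcPattern X k j)) := by
  change activationPattern X _ = _
  have h1 := orderSimplex_lo_nonneg h.linesAt.mem j
  have h2 := orderSimplex_hi_le_one h.linesAt.mem j
  rw [h.activationPattern_add_one_eq (by linarith [ht.1]) (by linarith [ht.2]),
    h.complPattern_arcPattern]
  exact h.linesAt.linePattern_of_mem _ ht

theorem gapMid_mem_Ioo (h : GenericRows X k) (j : Fin (m + 1)) :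
    gapMid (cuts X k) j ∈ Set.Ioo ((Fin.cons 0 (cuts X k) : Fin (m + 1) → ℝ) j)
      ((Fin.snoc (cuts X k) 1 : Fin (m + 1) → ℝ) j) :=
  ⟨lo_lt_gapMid h.linesAt.mem j, gapMid_lt_hi h.linesAt.mem j⟩

/-- Whether an endpoint belongs to a chamber depends on the orientation of its line, but endpoints
have measure zero, so bounds by the open and the closed arc suffice. -/
theorem chamberProb_eq_of_sandwich {D : Fin (m + 1) → Bool} {a b : ℝ} (ha : 0 ≤ a) (hb : b ≤ 2)
    (hab : a ≤ b) (h1 : ∀ t ∈ Set.Ioo a b, arcPoint X k t ∈ chamber X D)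
    (h2 : ∀ t, 0 ≤ t → t < 2 → arcPoint X k t ∈ chamber X D → t ∈ Set.Icc a b) :
    chamberProb X D = 1 / 2 * (b - a) := by
  have hv : volume {t | t ∈ Set.Ioo (0 : ℝ) 2 ∧
      circlePoint (rowAngle X k - Real.pi / 2 + Real.pi * t) ∈ chamber X D} =
        ENNReal.ofReal (b - a) := by
    apply le_antisymm
    · rw [← Real.volume_Icc]
      exact measure_mono fun t ht => h2 t ht.1.1.le ht.1.2 ht.2
    · rw [← Real.volume_Ioo]
      exact measure_mono fun t ht => ⟨⟨ha.trans_lt ht.1, ht.2.trans_le hb⟩, h1 t ht⟩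
  rw [chamberProb, Measure.real, circleUniform_apply_of_start (measurableSet_chamber X D)
    (rowAngle X k - Real.pi / 2), hv, ENNReal.toReal_mul, ENNReal.toReal_ofReal (by linarith)]
  simp

theorem chamberProb_arcPattern (h : GenericRows X k) (j : Fin (m + 1)) :
    chamberProb X (arcPattern X k j) = 1 / 2 * gaps m (1, cuts X k) j := by
  have h0 := orderSimplex_lo_nonneg h.linesAt.mem j
  have h1 := orderSimplex_hi_le_one h.linesAt.mem j
  exact chamberProb_eq_of_sandwich h0 (by linarith) (orderSimplex_lo_lt_hi h.linesAt.mem j).le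
    (fun t ht => h.arcPoint_mem_chamber ht) fun t h0 h2 ht => h.mem_Icc_of_mem_chamber h0 h2 ht

theorem chamberProb_complPattern (h : GenericRows X k) (j : Fin (m + 1)) :
    chamberProb X (complPattern (arcPattern X k j)) = 1 / 2 * gaps m (1, cuts X k) j := by
  have h0 := orderSimplex_lo_nonneg h.linesAt.mem j
  have h1 := orderSimplex_hi_le_one h.linesAt.mem j
  have h2 := orderSimplex_lo_lt_hi h.linesAt.mem j
  rw [chamberProb_eq_of_sandwich (k := k) (a := (Fin.cons 0 (cuts X k) : Fin (m + 1) → ℝ) j + 1)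
    (b := (Fin.snoc (cuts X k) 1 : Fin (m + 1) → ℝ) j + 1) (by linarith) (by linarith)
    (by linarith) ?_ fun t h0 h2 ht => h.mem_Icc_of_mem_chamber_compl h0 h2 ht]
  · rw [gaps_apply]
    ring
  · intro t ht
    rw [← sub_add_cancel t 1]
    exact h.arcPoint_add_one_mem_chamber ⟨by linarith [ht.1], by linarith [ht.2]⟩

theorem isPairedEnumeration (h : GenericRows X k) : IsPairedEnumeration X (arcPattern X k) := by
  refine ⟨?_, ?_, ?_⟩
  · rintro (j | j) -
    · exact ⟨_, h.arcPoint_mem_chamber (h.gapMid_mem_Ioo j)⟩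
    · exact ⟨_, h.arcPoint_add_one_mem_chamber (h.gapMid_mem_Ioo j)⟩
  · have hinj := h.linesAt.linePattern_injective (lineSide X k)
    have hinj' := h.linesAt.linePattern_injective fun i => !lineSide X k i
    have hne : ∀ i j, arcPattern X k i ≠ complPattern (arcPattern X k j) := by
      intro i j hij
      have := congrFun hij k
      simp [complPattern, h.arcPattern_self] at this
    rintro (i | i) - (j | j) - hij
    · exact congrArg _ (hinj hij)
    · exact absurd hij (hne i j)
    · exact absurd hij.symm (hne j i)
    · simp only [Sum.elim_inr, h.complPattern_arcPattern] at hij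
      exact congrArg _ (hinj' hij)
  · rintro D ⟨u, rfl⟩
    obtain ⟨t, h0, h2, rfl⟩ := exists_arcPoint X k u
    rcases le_or_gt t 1 with h1 | h1
    · obtain ⟨j, hj⟩ := h.linesAt.exists_linePattern_eq (lineAngle_self X k) h0 h1
        (Or.inr (lineSide_self X k))
      exact ⟨Sum.inl j, trivial, by rw [h.activationPattern_eq h0 h1, hj]; rfl⟩
    -- The point `t = 1` was handled with the first half-circle, so here `t - 1 > 0`, which is
    -- needed because row `k` has reversed orientation.
    · obtain ⟨j, hj⟩ := h.linesAt.exists_linePattern_eq (ε := fun i => !lineSide X k i)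
        (lineAngle_self X k) (t := t - 1) (by linarith) (by linarith) (Or.inl (by linarith))
      refine ⟨Sum.inr j, trivial, ?_⟩
      rw [← sub_add_cancel t 1, h.activationPattern_add_one_eq (by linarith) (by linarith), hj,
        Sum.elim_inr, h.complPattern_arcPattern]

theorem det_arcPoint (s t : ℝ) :
    (arcPoint X k s : EuclideanSpace ℝ (Fin 2)) 0 * (arcPoint X k t : EuclideanSpace ℝ (Fin 2)) 1 -
      (arcPoint X k s : EuclideanSpace ℝ (Fin 2)) 1 * (arcPoint X k t : EuclideanSpace ℝ (Fin 2)) 0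
        = Real.sin (Real.pi * (t - s)) := by
  simp only [arcPoint, circlePoint_zero, circlePoint_one]
  rw [show Real.pi * (t - s) = (rowAngle X k - Real.pi / 2 + Real.pi * t) -
    (rowAngle X k - Real.pi / 2 + Real.pi * s) by ring, Real.sin_sub]
  ring

theorem isCounterclockwiseFrom (h : GenericRows X k) :
    IsCounterclockwiseFrom X k (arcPattern X k) := by
  refine ⟨h.isPairedEnumeration, h.arcPattern_self, fun i j hij u hu v hv => ?_⟩
  obtain ⟨s, hs0, hs2, rfl⟩ := exists_arcPoint X k u
  obtain ⟨t, ht0, ht2, rfl⟩ := exists_arcPoint X k v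
  have hs := h.mem_Icc_of_mem_chamber hs0 hs2 hu
  have ht := h.mem_Icc_of_mem_chamber ht0 ht2 hv
  have h1 := orderSimplex_hi_le_lo h.linesAt.mem hij
  have h2 := orderSimplex_hi_le_one h.linesAt.mem j
  rw [det_arcPoint]
  have hst : s ≤ t := hs.2.trans (h1.trans ht.1)
  exact Real.sin_nonneg_of_nonneg_of_le_pi
    (mul_nonneg Real.pi_pos.le (by linarith)) (by nlinarith [Real.pi_pos, ht.2])

theorem complPattern_complPattern {n : ℕ} (D : Fin n → Bool) :
    complPattern (complPattern D) = D := by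
  ext i; simp [complPattern]

/-- Two indices sent to the same arc would have equal or complementary patterns; a listing without
repetition allows neither, so the index map is injective and thus a permutation. -/
theorem exists_perm (h : GenericRows X k) {D : Fin (m + 1) → Fin (m + 1) → Bool}
    (hD : IsPairedEnumeration X D) : ∃ τ : Equiv.Perm (Fin (m + 1)), ∀ j,
      D j = arcPattern X k (τ j) ∨ D j = complPattern (arcPattern X k (τ j)) := by
  have h1 : ∀ j, ∃ l, D j = arcPattern X k l ∨ D j = complPattern (arcPattern X k l) := by
    intro j
    obtain ⟨l | l, -, hl⟩ := h.isPairedEnumeration.surjOn (hD.mapsTo (Set.mem_univ (Sum.inl j)))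
    · exact ⟨l, Or.inl hl.symm⟩
    · exact ⟨l, Or.inr hl.symm⟩
  choose τ hτ using h1
  have hinj : Function.Injective τ := by
    intro i j hij
    have hi := hτ i
    have hj := hτ j
    rw [← hij] at hj
    have hor : D i = D j ∨ D i = complPattern (D j) := by
      rcases hi with hi | hi <;> rcases hj with hj | hj <;>
        simp [hi, hj, complPattern_complPattern]
    rcases hor with h' | h'
    · exact Sum.inl_injective (hD.injOn (Set.mem_univ (Sum.inl i)) (Set.mem_univ (Sum.inl j)) h')
    · have := hD.injOn (Set.mem_univ (Sum.inl i)) (Set.mem_univ (Sum.inr j)) h'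
      cases this
  exact ⟨Equiv.ofBijective τ (Finite.injective_iff_bijective.1 hinj), hτ⟩

/-- The entry of row `k` excludes complements. The determinant condition, tested at midpoints of
arcs, makes the remaining permutation monotone, hence the identity. -/
theorem eq_arcPattern (h : GenericRows X k) {D : Fin (m + 1) → Fin (m + 1) → Bool}
    (hD : IsCounterclockwiseFrom X k D) : D = arcPattern X k := by
  obtain ⟨τ, hτ⟩ := h.exists_perm hD.1
  have hτ' : ∀ j, D j = arcPattern X k (τ j) := by
    intro j
    refine (hτ j).resolve_right fun hc => ?_
    have := congrFun hc k
    simp [complPattern, h.arcPattern_self, hD.2.1] at this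
  have hmono : Monotone τ := by
    intro i j hij
    rcases hij.lt_or_eq with hlt | rfl
    · by_contra! hc
      have hdet := hD.2.2 i j hlt _ (hτ' i ▸ h.arcPoint_mem_chamber (h.gapMid_mem_Ioo (τ i))) _
        (hτ' j ▸ h.arcPoint_mem_chamber (h.gapMid_mem_Ioo (τ j)))
      have h1 := gapMid_mem h.linesAt.mem (τ i)
      have h2 := gapMid_mem h.linesAt.mem (τ j)
      have h3 := (h.gapMid_mem_Ioo (τ j)).2.trans_le ((orderSimplex_hi_le_lo h.linesAt.mem hc).trans
        (h.gapMid_mem_Ioo (τ i)).1.le)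
      rw [det_arcPoint, sin_pi_mul_nonneg_iff (by linarith [h1.2, h2.1])
        (by linarith [h1.1, h2.2])] at hdet
      linarith
    · exact le_rfl
  rw [Equiv.Perm.monotone_iff] at hmono
  ext1 j
  rw [hτ', hmono]
  rfl

theorem existsUnique_isCounterclockwiseFrom (h : GenericRows X k) :
    ∃! D, IsCounterclockwiseFrom X k D :=
  ⟨_, h.isCounterclockwiseFrom, fun _ hD => h.eq_arcPattern hD⟩

theorem exists_perm_chamberProb (h : GenericRows X k) {D : Fin (m + 1) → Fin (m + 1) → Bool}
    (hD : IsPairedEnumeration X D) : ∃ τ : Equiv.Perm (Fin (m + 1)),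
      (fun j => chamberProb X (D j)) = (fun j => 1 / 2 * gaps m (1, cuts X k) j) ∘ τ := by
  obtain ⟨τ, hτ⟩ := h.exists_perm hD
  refine ⟨τ, ?_⟩
  ext j
  rcases hτ j with hj | hj
  · rw [hj, h.chamberProb_arcPattern, Function.comp_apply]
  · rw [hj, h.chamberProb_complPattern, Function.comp_apply]

end GenericRows

/-! ### The law of the chamber probabilities -/

/-- Halves of the coordinates divided by their sum. -/
noncomputable def halfNormalized {n : ℕ} (x : Fin n → ℝ) : Fin n → ℝ :=
  fun j => 1 / 2 * (x j / ∑ i, x i)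

theorem measurable_halfNormalized (n : ℕ) : Measurable (halfNormalized (n := n)) :=
  measurable_pi_lambda _ fun j => ((measurable_pi_apply j).comp (measurable_normalized n)).const_mul _

theorem IsGaussianMatrix.hasLaw_gaps {Ω : Type*} [MeasurableSpace Ω] {P : Measure Ω}
    [IsProbabilityMeasure P] {m : ℕ} {X : Ω → Matrix (Fin (m + 1)) (Fin 2) ℝ}
    (hX : IsGaussianMatrix X P) (k : Fin (m + 1)) :
    HasLaw (fun ω j => 1 / 2 * gaps m (1, cuts (X ω) k) j)
      ((expPoints (m + 1)).map halfNormalized) P := by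
  have hhalf : Measurable fun (p : Fin (m + 1) → ℝ) j => 1 / 2 * p j := by fun_prop
  have h1 : MeasurePreserving (fun w : Fin m → ℝ => gaps m (1, sorted w)) (uniformPoints m)
      ((expPoints (m + 1)).map normalized) :=
    ⟨(measurable_gaps_one m).comp (measurable_sorted m), map_gaps_sorted_uniformPoints m⟩
  have h2 : MeasurePreserving (fun (p : Fin (m + 1) → ℝ) j => 1 / 2 * p j)
      ((expPoints (m + 1)).map normalized) ((expPoints (m + 1)).map halfNormalized) :=
    ⟨hhalf, Measure.map_map hhalf (measurable_normalized _)⟩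
  exact (h2.comp h1).comp_hasLaw (hX.hasLaw_relAngles k)

theorem IsIIDExp.hasLaw {Ω : Type*} [MeasurableSpace Ω] {Q : Measure Ω} {n : ℕ}
    {E : Fin n → Ω → ℝ} (hE : IsIIDExp E Q) :
    HasLaw (fun ω j => (1 / 2 : ℝ) * (E j ω / ∑ i, E i ω)) ((expPoints n).map halfNormalized) Q :=
  (MeasurePreserving.mk (measurable_halfNormalized n) rfl).comp_hasLaw (hE.1.hasLaw_pi hE.2)

/-- The relabelling may vary with `ω`, even non-measurably: since `S` is permutation-invariant, the
event agrees almost everywhere with the one for the arcs counted from row `0`, an arbitrary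
reference. -/
theorem IsGaussianMatrix.measure_chamberProb_mem {Ω : Type*} [MeasurableSpace Ω] {P : Measure Ω}
    [IsProbabilityMeasure P] {m : ℕ} {X : Ω → Matrix (Fin (m + 1)) (Fin 2) ℝ}
    (hX : IsGaussianMatrix X P) {D : Ω → Fin (m + 1) → Fin (m + 1) → Bool}
    (hD : ∀ᵐ ω ∂P, IsPairedEnumeration (X ω) (D ω)) {S : Set (Fin (m + 1) → ℝ)}
    (hS : MeasurableSet S)
    (hperm : ∀ (σ : Equiv.Perm (Fin (m + 1))) (p : Fin (m + 1) → ℝ), p ∈ S → p ∘ σ ∈ S) :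
    P {ω | (fun j => chamberProb (X ω) (D ω j)) ∈ S} =
      (expPoints (m + 1)).map halfNormalized S := by
  refine Eq.trans (measure_congr ?_) ((hX.hasLaw_gaps 0).measure_eq (p := (· ∈ S)) hS)
  filter_upwards [hX.ae_genericRows 0, hD] with ω hω hDω
  obtain ⟨τ, hτ⟩ := hω.exists_perm_chamberProb hDω
  apply propext
  change (fun j => chamberProb (X ω) (D ω j)) ∈ S ↔ _ ∈ S
  rw [hτ]
  refine ⟨fun h => ?_, fun h => hperm τ _ h⟩
  have := hperm τ⁻¹ _ h
  rwa [Function.comp_assoc, ← Equiv.Perm.coe_mul, mul_inv_cancel, Equiv.Perm.coe_one,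
    Function.comp_id] at this

/-! ### Exponential tails and the smallest coordinate -/

theorem expMeasure_one_Ioi {x : ℝ} (hx : 0 ≤ x) :
    expMeasure 1 (Set.Ioi x) = ENNReal.ofReal (Real.exp (-x)) := by
  have h := cdf_expMeasure_eq one_pos x
  rw [cdf_eq_real, if_pos hx, one_mul] at h
  have h2 := probReal_compl_eq_one_sub (μ := expMeasure 1) (measurableSet_Iic (a := x))
  rw [h, Set.compl_Iic, sub_sub_cancel] at h2
  rw [← h2, ofReal_measureReal]

/-- Multiplying the rate-one density by `e^{-x}` gives half the density of rate two. -/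
theorem lintegral_exp_neg_expMeasure :
    ∫⁻ x, ENNReal.ofReal (Real.exp (-x)) ∂expMeasure 1 = 2⁻¹ := by
  have h : ∫⁻ x, exponentialPDF 2 x = 1 := lintegral_exponentialPDF_eq_one two_pos
  have h2 : ∀ x, exponentialPDF 2 x =
      2 * (exponentialPDF 1 x * ENNReal.ofReal (Real.exp (-x))) := by
    intro x
    rw [exponentialPDF_eq, exponentialPDF_eq]
    split_ifs
    · rw [← ENNReal.ofReal_mul (by positivity), ← ENNReal.ofReal_ofNat 2,
        ← ENNReal.ofReal_mul zero_le_two, one_mul, one_mul, ← Real.exp_add]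
      congr 3
      ring
    · simp
  have hm : Measurable (exponentialPDF 1) := (measurable_exponentialPDFReal 1).ennreal_ofReal
  simp only [h2] at h
  rw [lintegral_const_mul _ (by fun_prop)] at h
  change ∫⁻ x, _ ∂(volume.withDensity (exponentialPDF 1)) = _
  rw [lintegral_withDensity_eq_lintegral_mul _ hm (by fun_prop)]
  rw [mul_comm] at h
  exact ENNReal.eq_inv_of_mul_eq_one_left h

/-- Chernoff bound with parameter one: `e^{-∑ x}` has mean `2^{-n}`, and Markov's inequality at
level `e^{-n/2}` gives `e^{n/2} 2^{-n}`. -/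
theorem expPoints_sum_lt_le (n : ℕ) :
    expPoints n {x | ∑ i, x i < n / 2} ≤ ENNReal.ofReal (Real.exp (-(Real.log 2 - 1 / 2) * n)) := by
  have hf : Measurable fun x : Fin n → ℝ => ∏ i, ENNReal.ofReal (Real.exp (-x i)) :=
    Finset.measurable_prod _ fun i _ => by fun_prop
  have hI : ∫⁻ x, ∏ i, ENNReal.ofReal (Real.exp (-x i)) ∂expPoints n = 2⁻¹ ^ n := by
    rw [expPoints, lintegral_pi_prod (expMeasure 1)
      (fun (_ : Fin n) t => ENNReal.ofReal (Real.exp (-t))) fun i => by fun_prop]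
    simp [lintegral_exp_neg_expMeasure]
  have hsub : {x : Fin n → ℝ | ∑ i, x i < n / 2} ⊆
      {x | ENNReal.ofReal (Real.exp (-(n / 2 : ℝ))) ≤ ∏ i, ENNReal.ofReal (Real.exp (-x i))} := by
    intro x hx
    have hx' : ∑ i, x i < n / 2 := hx
    rw [Set.mem_ofPred_eq, ← ENNReal.ofReal_prod_of_nonneg fun i _ => (Real.exp_pos _).le,
      ← Real.exp_sum, Finset.sum_neg_distrib]
    exact ENNReal.ofReal_le_ofReal (Real.exp_le_exp.2 (by linarith))
  refine (measure_mono hsub).trans ((meas_ge_le_lintegral_div hf.aemeasurable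
    (by simp [Real.exp_pos]) ENNReal.ofReal_ne_top).trans ?_)
  rw [hI, ← ENNReal.ofReal_ofNat 2, ← ENNReal.ofReal_inv_of_pos two_pos,
    ← ENNReal.ofReal_pow (by positivity), ← ENNReal.ofReal_div_of_pos (Real.exp_pos _)]
  refine ENNReal.ofReal_le_ofReal (le_of_eq ?_)
  have h2 : (2⁻¹ : ℝ) = Real.exp (-Real.log 2) := by
    rw [Real.exp_neg, Real.exp_log two_pos]
  rw [h2, ← Real.exp_nat_mul, ← Real.exp_sub]
  congr 1
  ring

theorem expPoints_forall_gt {n : ℕ} (hn : n ≠ 0) {x : ℝ} (hx : 0 ≤ x) :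
    expPoints n {y | ∀ i, x / n < y i} = ENNReal.ofReal (Real.exp (-x)) := by
  have h : {y : Fin n → ℝ | ∀ i, x / n < y i} = Set.pi Set.univ fun _ => Set.Ioi (x / n) := by
    ext y; simp
  rw [h, expPoints, Measure.pi_pi]
  simp only [expMeasure_one_Ioi (div_nonneg hx (Nat.cast_nonneg n)), Finset.prod_const,
    Finset.card_univ, Fintype.card_fin]
  rw [← ENNReal.ofReal_pow (Real.exp_pos _).le, ← Real.exp_nat_mul]
  congr 2
  have : (n : ℝ) ≠ 0 := Nat.cast_ne_zero.2 hn
  field_simp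

/-- If the minimum exceeds `K / n²`, then either the sum is below `n / 2` or every coordinate
exceeds `2 (K / n²) (n / 2) = K / n`; a union bound finishes. -/
theorem map_halfNormalized_iInf_le {m : ℕ} {K : ℝ} (hK : 0 < K) :
    1 - Real.exp (-K) - Real.exp (-(Real.log 2 - 1 / 2) * (m + 1 : ℕ)) ≤
      ((expPoints (m + 1)).map halfNormalized).real {p | ⨅ j, p j ≤ K / ((m + 1 : ℕ) : ℝ) ^ 2} := by
  set n := m + 1 with hn
  have hn0 : (0 : ℝ) < n := by positivity
  have hS : MeasurableSet {p : Fin n → ℝ | ⨅ j, p j ≤ K / (n : ℝ) ^ 2} :=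
    measurableSet_le (Measurable.iInf fun j => measurable_pi_apply j) measurable_const
  rw [map_measureReal_apply (measurable_halfNormalized n) hS]
  have hsub : (halfNormalized ⁻¹' {p : Fin n → ℝ | ⨅ j, p j ≤ K / (n : ℝ) ^ 2})ᶜ ⊆
      {y | ∀ i, K / n < y i} ∪ {x | ∑ i, x i < n / 2} := by
    intro x hx
    rw [Set.mem_compl_iff, Set.mem_preimage, Set.mem_ofPred_eq, not_le] at hx
    rw [Set.mem_union, Set.mem_ofPred_eq, Set.mem_ofPred_eq, or_iff_not_imp_right, not_lt]
    intro hsum i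
    have hi : K / (n : ℝ) ^ 2 < 1 / 2 * (x i / ∑ i, x i) :=
      hx.trans_le (ciInf_le (Set.finite_range _).bddBelow i)
    have hs : 0 < ∑ i, x i := lt_of_lt_of_le (by positivity) hsum
    rw [← mul_div_assoc, lt_div_iff₀ hs] at hi
    have h1 : K / (n : ℝ) ^ 2 * (n / 2) ≤ K / (n : ℝ) ^ 2 * ∑ i, x i :=
      mul_le_mul_of_nonneg_left hsum (by positivity)
    have h2 : K / (n : ℝ) ^ 2 * (n / 2) = 1 / 2 * (K / n) := by
      field_simp
    linarith
  have h1 := (measureReal_mono hsub).trans (measureReal_union_le (μ := expPoints n) _ _)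
  rw [probReal_compl_eq_one_sub (measurable_halfNormalized n hS)] at h1
  have h2 : (expPoints n).real {y | ∀ i, K / n < y i} = Real.exp (-K) := by
    rw [Measure.real, expPoints_forall_gt (Nat.succ_ne_zero m) hK.le,
      ENNReal.toReal_ofReal (Real.exp_pos _).le]
  have h3 : (expPoints n).real {x | ∑ i, x i < n / 2} ≤ Real.exp (-(Real.log 2 - 1 / 2) * n) :=
    ENNReal.toReal_le_of_le_ofReal (Real.exp_pos _).le (expPoints_sum_lt_le n)
  linarith

/-! ### The main theorem -/

theorem theorem1 :
    -- joint law of the chamber probabilities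
    (∀ (n : ℕ) (_ : 1 ≤ n)
      {Ω : Type*} [MeasurableSpace Ω] (P : Measure Ω) [IsProbabilityMeasure P]
      (X : Ω → Matrix (Fin n) (Fin 2) ℝ) (_ : IsGaussianMatrix X P)
      {Ω' : Type*} [MeasurableSpace Ω'] (Q : Measure Ω') [IsProbabilityMeasure Q]
      (E : Fin n → Ω' → ℝ) (_ : IsIIDExp E Q),
      -- almost surely there are exactly `2n` patterns, in `n` complementary pairs
      (∀ k : Fin n, ∀ᵐ ω ∂P, ∃! D : Fin n → Fin n → Bool, IsCounterclockwiseFrom (X ω) k D) ∧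
      -- joint law, for the chambers listed in cyclic order starting at the line of any given row
      (∀ (k : Fin n) (D : Ω → Fin n → Fin n → Bool),
        (∀ᵐ ω ∂P, IsCounterclockwiseFrom (X ω) k (D ω)) →
        IdentDistrib (fun ω j => chamberProb (X ω) (D ω j))
          (fun ω' j => (1 / 2 : ℝ) * (E j ω' / ∑ i, E i ω')) P Q) ∧
      -- joint law up to relabelling, for every enumeration of the chambers
      (∀ D : Ω → Fin n → Fin n → Bool,
        (∀ᵐ ω ∂P, IsPairedEnumeration (X ω) (D ω)) →
        ∀ S : Set (Fin n → ℝ), MeasurableSet S →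
          (∀ (σ : Equiv.Perm (Fin n)) (p : Fin n → ℝ), p ∈ S → p ∘ σ ∈ S) →
          P {ω | (fun j => chamberProb (X ω) (D ω j)) ∈ S} =
            Q {ω' | (fun j => (1 / 2 : ℝ) * (E j ω' / ∑ i, E i ω')) ∈ S})) ∧
    -- the smallest chamber
    (∃ C > (0 : ℝ), ∃ K > (0 : ℝ), ∀ (n : ℕ) (_ : 1 ≤ n)
      {Ω : Type*} [MeasurableSpace Ω] (P : Measure Ω) [IsProbabilityMeasure P]
      (X : Ω → Matrix (Fin n) (Fin 2) ℝ) (_ : IsGaussianMatrix X P)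
      (D : Ω → Fin n → Fin n → Bool),
      (∀ᵐ ω ∂P, IsPairedEnumeration (X ω) (D ω)) →
      1 - Real.exp (-20) - Real.exp (-C * n) ≤
        P.real {ω | (⨅ j : Fin n, chamberProb (X ω) (D ω j)) ≤ K / (n : ℝ) ^ 2}) := by
  refine ⟨fun n hn Ω _ P _ X hX Ω' _ Q _ E hE => ?_,
    -- `C` is the Chernoff rate, positive because `log 2 > 1 / 2`; `K = 20` turns `e^{-K}` into
    -- `e^{-20}`.
    Real.log 2 - 1 / 2, by linarith [Real.log_two_gt_d9], 20, by norm_num,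
    fun n hn Ω _ P _ X hX D hD => ?_⟩
  · obtain ⟨m, rfl⟩ := Nat.exists_eq_add_of_le' hn
    refine ⟨fun k => ?_, fun k D hD => ?_, fun D hD S hS hperm => ?_⟩
    · filter_upwards [hX.ae_genericRows k] with ω hω
      exact hω.existsUnique_isCounterclockwiseFrom
    · have h : HasLaw (fun ω j => chamberProb (X ω) (D ω j))
          ((expPoints (m + 1)).map halfNormalized) P := by
        refine (hX.hasLaw_gaps k).congr ?_
        filter_upwards [hX.ae_genericRows k, hD] with ω hω hDω
        ext j
        rw [hω.eq_arcPattern hDω, hω.chamberProb_arcPattern]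
      exact ⟨h.aemeasurable, hE.hasLaw.aemeasurable, h.map_eq.trans hE.hasLaw.map_eq.symm⟩
    · rw [hX.measure_chamberProb_mem hD hS hperm]
      exact (hE.hasLaw.measure_eq (p := (· ∈ S)) hS).symm
  · obtain ⟨m, rfl⟩ := Nat.exists_eq_add_of_le' hn
    refine (map_halfNormalized_iInf_le (m := m) (K := 20) (by norm_num)).trans (le_of_eq ?_)
    rw [Measure.real, Measure.real, ← hX.measure_chamberProb_mem hD]
    · rfl
    · exact measurableSet_le (Measurable.iInf fun j => measurable_pi_apply j) measurable_const
    · intro σ p hp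
      rw [Set.mem_ofPred_eq] at hp ⊢
      rwa [show ⨅ j, (p ∘ σ) j = ⨅ j, p j from Equiv.iInf_comp (g := p) σ]
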